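/- **Setting.** Let $V$ be a reflexive separable real Banach space, continuously (by an injective map) and densely embedded in a real Hilbert space $H$; identifying $H$ with its dual gives $V\hookrightarrow H\hookrightarrow V^*$, with duality $\langle\cdot,\cdot\rangle$. Let $T>0$ and let $(\Omega,\mathcal F,(\mathcal F_t),\mathbb P)$ be a complete filtered probability space satisfying the usual conditions. Let $U$ be a separable Hilbert space with orthonormal basis $g_1,g_2,\dots$ (finite or infinite), let $W$ be an adapted cylindrical Wiener process on $[0,T]$ in $U$ such that $W_t-W_s$ is independent of $\mathcal F_s$ for $s<t$, and let $N$ be an adapted Poisson random measure on $[0,T]\times E$, independent of $W$, with intensity $dt\otimes\nu$, where $\nu$ is a $\sigma$-finite Borel measure on a metric space $E$, such that $N((s,t],\cdot)$ is independent of $\mathcal F_s$. Put $\tilde N=N-dt\otimes\nu$. Let $L_2(U,H)$ be the space of Hilbert–Schmidt operators, with norm $\|\cdot\|_2$. Let $$A:[0,T]\times\Omega\times V\to V^*,\qquad B:[0,T]\times\Omega\times V\to L_2(U,H),\qquad F:[0,T]\times\Omega\times V\times E\to H$$ be such that $A,B$ are measurable with respect to the product of the progressive $\sigma$-field on $[0,T]\times\Omega$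 and $\mathcal B(V)$, and $F$ is measurable with respect to the product of the predictable $\sigma$-field, $\mathcal B(V)$ and $\mathcal B(E)$. Let $p\in[2,\infty)$, $1/p+1/q=1$, let $K_1,\bar K_1,K_2$ be nonnegative integrable functions and $\lambda$ a positive integrable function on $[0,T]$. Assume: * (C1) a.s. for all $x,y\in V$, $t\in[0,T]$: $2\langle A_t(x)-A_t(y),x-y\rangle+\|B_t(x)-B_t(y)\|_2^2+\int_E\|F_t(x,\xi)-F_t(y,\xi)\|_H^2\,\nu(d\xi)\le 0$; * (C2) a.s. for all $x\in V$, $t\in[0,T]$: $2\langle A_t(x),x\rangle+\|B_t(x)\|_2^2+\int_E\|F_t(x,\xi)\|_H^2\,\nu(d\xi)+\lambda(t)\|x\|_V^p\le K_1(t)+\bar K_1(t)\|x\|_H^2$; * (C3) there is $\alpha\ge1$ such that a.s. for all $x\in V$, $t\in[0,T]$: $\|A_t(x)\|_{V^*}^q\le\alpha\lambda^q(t)\|x\|_V^p+K_2(t)\lambda^{q-1}(t)$; * (C4) a.s. for all $x,y,z\in V$, $t\in[0,T]$: $\lim_{\epsilon\to0}\langle A_t(x+\epsilon y),z\rangle=\langle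 A_t(x),z\rangle$; * (C5) $\zeta\in L^2(\Omega,\mathcal F_0;H)$; * (C6) there are compact sets $E^1\subseteq E^2\subseteq\cdots$ of finite $\nu$-measure with $\bigcup_lE^l=E$. **Discretization.** Let $V_1\subseteq V_2\subseteq\cdots$ be finite dimensional subspaces of $V$ with union dense in $V$, with nested bases $\{e_1,\dots,e_{l_n}\}$ of $V_n$ that are orthonormal in $H$, and let $\Pi_nx=\sum_{k\le l_n}\langle e_k,x\rangle e_k$ for $x\in V^*$. Let $W^l_t=\sum_{k\le l}(W_t,g_k)_U\,g_k$. For each $l$ let $\{E^l_1,\dots,E^l_{r_l}\}$ be a measurable partition of $E^l$ finer than $\{E^1,E^2\setminus E^1,\dots,E^l\setminus E^{l-1}\}$ with $\operatorname{diam}E^l_j<\varepsilon_l$, where $\varepsilon_l\downarrow0$. For $m\ge1$ let $\delta_m=T/m$, $t_i=i\delta_m$, and $$A^m_{t_i}(x)=\frac1{\delta_m}\int_{t_{i-1}}^{t_i}A_s(x)\,ds\quad(1\le i\le m),\qquad \tilde B^m_{t_i}(x)=\frac1{\delta_m}\int_{t_{i-2}}^{t_{i-1}}B_s(x)\,ds\quad(2\le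 i\le m),$$ $$\tilde F^{m,l}_{t_i}(x,\xi)=\frac1{\delta_m\nu(E^l_j)}\int_{t_{i-2}}^{t_{i-1}}\int_{E^l_j}F_s(x,\eta)\,\nu(d\eta)\,ds\quad(\xi\in E^l_j,\ 2\le i\le m)$$ (read as $0$ if $\nu(E^l_j)=0$), $\tilde F^{m,l}_{t_i}(x,\xi)=0$ for $\xi\notin E^l$, and $\tilde B^m_{t_1}=0$, $\tilde F^{m,l}_{t_1}=0$. **Theorem.** (a) There is an integer $m_0\ge1$ such that for all $m\ge m_0$ and $l\ge1$ there are $V$-valued random variables $u(t_i)=u^{m,l}(t_i)$, $1\le i\le m$, which, with $u(t_0)=\zeta$, satisfy almost surely, for $i=1,\dots,m$, the equation in $V^*$ $$u(t_i)=u(t_{i-1})+\delta_mA^m_{t_i}(u(t_i))+\tilde B^m_{t_i}(u(t_{i-1}))\bigl(W^l_{t_i}-W^l_{t_{i-1}}\bigr)+\int_E\tilde F^{m,l}_{t_i}(u(t_{i-1}),\xi)\,\tilde N((t_{i-1},t_i],d\xi);$$ $u(t_i)$ is $\mathcal F_{t_i}$-measurable with $\mathbb E\|u(t_i)\|_V^p<\infty$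 for $i=1,\dots,m$; and any family of $V$-valued functions on $\Omega$ satisfying these equations almost surely coincides almost surely with $(u(t_i))_{1\le i\le m}$. (b) There is an integer $m_0\ge1$ such that for all $m\ge m_0$ and $n,l\ge1$ there are $V$-valued random variables $u(t_i)=u^{n,m,l}(t_i)$, $0\le i\le m$, with $u(t_0)=\Pi_n\zeta$ which satisfy almost surely, for $i=1,\dots,m$, $$u(t_i)=u(t_{i-1})+\delta_m\Pi_nA^m_{t_i}(u(t_i))+\Pi_n\tilde B^m_{t_i}(u(t_{i-1}))\bigl(W^l_{t_i}-W^l_{t_{i-1}}\bigr)+\int_E\Pi_n\tilde F^{m,l}_{t_i}(u(t_{i-1}),\xi)\,\tilde N((t_{i-1},t_i],d\xi);$$ $u(t_i)$ is $\mathcal F_{t_i}$-measurable for $i=0,\dots,m$, $\mathbb E\|u(t_i)\|_V^p<\infty$ for $i=1,\dots,m$, and also for $i=0$ if $\mathbb E\|\zeta\|_H^p<\infty$ (in particular if $p=2$); and any family of $V$-valued functions on $\Omega$ satisfying these equations almost surely coincides almost surely with $(u(t_i))_{0\le i\le m}$. -/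

import Mathlib

open MeasureTheory ProbabilityTheory Filter Topology
open scoped NNReal ENNReal

noncomputable section

/-! ### Hilbert-Schmidt operators -/

section HilbertSchmidt

variable {ι U : Type*} [NormedAddCommGroup U] [InnerProductSpace ℝ U]

/-- The linear space of the Hilbert-Schmidt operators `S : U → H`, i.e. those bounded operators with
`∑ₖ ‖S gₖ‖² < ∞` for an orthonormal basis `g` of `U`
(by `tsum_enorm_sq_basis_indep` the sum does not depend on the basis). -/
def hilbertSchmidtSubmodule (g : HilbertBasis ι ℝ U) (H : Type*) [NormedAddCommGroup H]
    [InnerProductSpace ℝ H] : Submodule ℝ (U →L[ℝ] H) where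
  carrier := {S | Memℓp (fun k => S (g k)) 2}
  add_mem' := fun {a b} ha hb => by
    have h : Memℓp ((fun k => a (g k)) + fun k => b (g k)) 2 := Memℓp.add ha hb
    exact h
  zero_mem' := by
    have h : Memℓp (0 : ι → H) 2 := zero_memℓp
    exact h
  smul_mem' := fun c a ha => by
    have h : Memℓp (c • fun k => a (g k)) 2 := Memℓp.const_smul ha c
    exact h

/-- The space `L₂(U, H)` of Hilbert-Schmidt operators (with the Hilbert-Schmidt norm, see below). -/
def HilbertSchmidt (g : HilbertBasis ι ℝ U) (H : Type*) [NormedAddCommGroup H]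
    [InnerProductSpace ℝ H] : Type _ := hilbertSchmidtSubmodule g H

namespace HilbertSchmidt

variable (g : HilbertBasis ι ℝ U) (H : Type*) [NormedAddCommGroup H] [InnerProductSpace ℝ H]

instance : AddCommGroup (HilbertSchmidt g H) :=
  inferInstanceAs (AddCommGroup (hilbertSchmidtSubmodule g H))

instance : Module ℝ (HilbertSchmidt g H) :=
  inferInstanceAs (Module ℝ (hilbertSchmidtSubmodule g H))

variable {g H} in
/-- The bounded operator underlying a Hilbert-Schmidt operator. -/
def toCLM (S : HilbertSchmidt g H) : U →L[ℝ] H := S.1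

/-- The isometry `S ↦ (S gₖ)ₖ` of `L₂(U, H)` into `ℓ²(H)`. -/
def toSeq : HilbertSchmidt g H →ₗ[ℝ] lp (fun _ : ι => H) 2 where
  toFun S := ⟨fun k => S.toCLM (g k), S.2⟩
  map_add' _ _ := rfl
  map_smul' _ _ := rfl

theorem toSeq_injective : Function.Injective (toSeq g H) := by
  intro S R h
  have hk : ∀ k, S.toCLM (g k) = R.toCLM (g k) := fun k =>
    congrFun (congrArg (fun f : lp (fun _ : ι => H) 2 => (f : ι → H)) h) k
  have hSR : S.toCLM = R.toCLM := by
    refine ContinuousLinearMap.ext_on (s := Set.range g) ?_ ?_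
    · have := g.dense_span
      rw [Submodule.dense_iff_topologicalClosure_eq_top]
      exact this
    · rintro _ ⟨k, rfl⟩
      exact hk k
  exact Subtype.ext hSR

/-- The Hilbert-Schmidt norm `‖S‖₂ = (∑ₖ ‖S gₖ‖²)^{1/2}`. -/
instance : NormedAddCommGroup (HilbertSchmidt g H) :=
  NormedAddCommGroup.induced _ _ (toSeq g H) (toSeq_injective g H)

instance : NormedSpace ℝ (HilbertSchmidt g H) :=
  NormedSpace.induced ℝ _ _ (toSeq g H)

instance : MeasurableSpace (HilbertSchmidt g H) := borel _

instance : BorelSpace (HilbertSchmidt g H) := ⟨rfl⟩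

variable {g H} in
theorem norm_sq_eq (S : HilbertSchmidt g H) : ‖S‖ ^ 2 = ∑' k, ‖S.toCLM (g k)‖ ^ 2 := by
  have h := lp.norm_rpow_eq_tsum (p := 2) (by norm_num) (toSeq g H S)
  have h2 : ‖S‖ = ‖toSeq g H S‖ := rfl
  simp only [ENNReal.toReal_ofNat, Real.rpow_ofNat] at h
  rw [h2]
  exact h

/-- `L₂(U, H)` is complete, so that Bochner integrals of `L₂(U, H)`-valued functions make sense. -/
instance [CompleteSpace H] : CompleteSpace (HilbertSchmidt g H) := by
  have hsurj : Function.Surjective (toSeq g H) := by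
    intro f
    have hf : Summable fun k => ‖f k‖ ^ (2 : ℝ) := by
      have := (memℓp_gen_iff (p := 2) (by norm_num)).1 f.2
      simpa using this
    have hu : ∀ u : U, Summable fun k => ‖g.repr u k‖ ^ (2 : ℝ) := fun u => by
      have := (memℓp_gen_iff (p := 2) (by norm_num)).1 (g.repr u).2
      simpa using this
    have hun : ∀ u : U, ‖u‖ ^ (2 : ℝ) = ∑' k, ‖g.repr u k‖ ^ (2 : ℝ) := fun u => by
      have := lp.norm_rpow_eq_tsum (p := 2) (by norm_num) (g.repr u)
      simpa using this
    have hfn : ‖f‖ ^ (2 : ℝ) = ∑' k, ‖f k‖ ^ (2 : ℝ) := by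
      have := lp.norm_rpow_eq_tsum (p := 2) (by norm_num) f
      simpa using this
    have h2 : (2 : ℝ).HolderConjugate 2 := Real.HolderConjugate.two_two
    have hs : ∀ u : U, Summable fun k => ‖g.repr u k • f k‖ := fun u => by
      simp_rw [norm_smul]
      exact Real.summable_mul_of_Lp_Lq_of_nonneg h2 (fun _ => norm_nonneg _)
        (fun _ => norm_nonneg _) (hu u) hf
    have hb : ∀ u : U, ‖∑' k, g.repr u k • f k‖ ≤ ‖f‖ * ‖u‖ := fun u => by
      refine (norm_tsum_le_tsum_norm (hs u)).trans ?_
      simp_rw [norm_smul]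
      refine (Real.inner_le_Lp_mul_Lq_tsum_of_nonneg h2 (fun _ => norm_nonneg _)
        (fun _ => norm_nonneg _) (hu u) hf).trans ?_
      rw [← hun, ← hfn, ← Real.rpow_mul (norm_nonneg _), ← Real.rpow_mul (norm_nonneg _)]
      norm_num
      rw [mul_comm]
    let L : U →ₗ[ℝ] H :=
      { toFun := fun u => ∑' k, g.repr u k • f k
        map_add' := fun u v => by
          rw [← (hs u).of_norm.tsum_add (hs v).of_norm]
          refine tsum_congr fun k => ?_
          rw [← add_smul]; simp
        map_smul' := fun c u => by
          rw [RingHom.id_apply, ← (hs u).of_norm.tsum_const_smul]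
          refine tsum_congr fun k => ?_
          rw [smul_smul]; simp }
    have hL : ∀ k, L.mkContinuous ‖f‖ hb (g k) = f k := fun k => by
      classical
      change ∑' i, g.repr (g k) i • f i = f k
      rw [tsum_eq_single k]
      · rw [HilbertBasis.repr_self]; simp
      · intro i hi
        rw [HilbertBasis.repr_self]; simp [hi]
    refine ⟨⟨L.mkContinuous ‖f‖ hb, ?_⟩, ?_⟩
    · change Memℓp (fun k => L.mkContinuous ‖f‖ hb (g k)) 2
      simp_rw [hL]
      exact f.2
    · ext k
      exact hL k
  exact (LinearIsometryEquiv.ofSurjective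
    (⟨toSeq g H, fun _ => rfl⟩ : HilbertSchmidt g H →ₗᵢ[ℝ] lp (fun _ : ι => H) 2)
      hsurj).toIsometryEquiv.completeSpace

end HilbertSchmidt

/-- Parseval's identity in `ℝ≥0∞`. -/
theorem enorm_sq_eq_tsum_enorm_inner_sq {κ K : Type*} [NormedAddCommGroup K]
    [InnerProductSpace ℝ K] (b : HilbertBasis κ ℝ K) (x : K) :
    ‖x‖ₑ ^ 2 = ∑' i, ‖inner ℝ (b i) x‖ₑ ^ 2 := by
  have h := lp.hasSum_norm (p := 2) (by norm_num) (b.repr x)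
  simp only [ENNReal.toReal_ofNat, Real.rpow_ofNat, LinearIsometryEquiv.norm_map,
    HilbertBasis.repr_apply_apply] at h
  rw [← ofReal_norm, ← ENNReal.ofReal_pow (norm_nonneg _), ← h.tsum_eq,
    ENNReal.ofReal_tsum_of_nonneg (fun _ => by positivity) h.summable]
  refine tsum_congr fun i => ?_
  rw [← ofReal_norm, ← ENNReal.ofReal_pow (norm_nonneg _)]

theorem tsum_enorm_sq_eq_adjoint [CompleteSpace U] {κ H : Type*} [NormedAddCommGroup H]
    [InnerProductSpace ℝ H] [CompleteSpace H] (g : HilbertBasis ι ℝ U) (b : HilbertBasis κ ℝ H)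
    (S : U →L[ℝ] H) : ∑' k, ‖S (g k)‖ₑ ^ 2 = ∑' i, ‖S.adjoint (b i)‖ₑ ^ 2 := by
  simp_rw [enorm_sq_eq_tsum_enorm_inner_sq b (S _), enorm_sq_eq_tsum_enorm_inner_sq g (S.adjoint _)]
  rw [ENNReal.tsum_comm]
  refine tsum_congr fun i => tsum_congr fun k => ?_
  rw [ContinuousLinearMap.adjoint_inner_right, real_inner_comm]

/-- The sum defining the Hilbert-Schmidt norm does not depend on the orthonormal basis. -/
theorem tsum_enorm_sq_basis_indep [CompleteSpace U] {ι' H : Type*} [NormedAddCommGroup H]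
    [InnerProductSpace ℝ H] [CompleteSpace H] (g : HilbertBasis ι ℝ U) (g' : HilbertBasis ι' ℝ U)
    (S : U →L[ℝ] H) : ∑' k, ‖S (g k)‖ₑ ^ 2 = ∑' k, ‖S (g' k)‖ₑ ^ 2 := by
  obtain ⟨w, b, -⟩ := exists_hilbertBasis ℝ H
  rw [tsum_enorm_sq_eq_adjoint g b, tsum_enorm_sq_eq_adjoint g' b]

end HilbertSchmidt

/-! ### Time, filtration, measurability -/

/-- Lebesgue measure `dt` on the time axis `[0, ∞)`. -/
def timeMeasure : Measure ℝ≥0 := (volume : Measure ℝ).comap (fun t : ℝ≥0 => (t : ℝ))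

theorem timeMeasure_Ioc (a b : ℝ≥0) :
    timeMeasure (Set.Ioc a b) = ENNReal.ofReal ((b : ℝ) - a) := by
  have he : MeasurableEmbedding (fun t : ℝ≥0 => (t : ℝ)) :=
    MeasurableEmbedding.subtype_coe measurableSet_Ici
  have hi : (fun t : ℝ≥0 => (t : ℝ)) '' Set.Ioc a b = Set.Ioc (a : ℝ) b := by
    ext x
    constructor
    · rintro ⟨t, ht, rfl⟩
      exact ⟨NNReal.coe_lt_coe.2 ht.1, NNReal.coe_le_coe.2 ht.2⟩
    · intro hx
      exact ⟨⟨x, a.2.trans hx.1.le⟩, ⟨hx.1, hx.2⟩, rfl⟩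
  rw [timeMeasure, he.comap_apply, hi, Real.volume_Ioc]

section Filtration

variable {Ω : Type*} {mΩ : MeasurableSpace Ω}

/-- The usual conditions: `𝓕` is right continuous and `𝓕 0` contains all `P`-null sets
(in particular the probability space is complete). -/
def UsualConditions (P : Measure Ω) (𝓕 : Filtration ℝ≥0 mΩ) : Prop :=
  𝓕.IsRightContinuous ∧ ∀ S : Set Ω, P S = 0 → MeasurableSet[𝓕 0] S

/-- The σ-field of progressively measurable subsets of `[0, T] × Ω`: those `S` such that, for every
`t ≤ T`, the set `S ∩ ([0, t] × Ω)` lies in the product of the Borel sets of `[0, t]` and `𝓕 t`. -/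
@[reducible] def progressiveSigma (𝓕 : Filtration ℝ≥0 mΩ) (T : ℝ≥0) : MeasurableSpace (Set.Iic T × Ω) :=
  ⨅ t : Set.Iic T, MeasurableSpace.map
    (fun z : Set.Iic (t : ℝ≥0) × Ω =>
      ((⟨z.1, Set.mem_Iic.2 (le_trans (Set.mem_Iic.1 z.1.2) (Set.mem_Iic.1 t.2))⟩ : Set.Iic T), z.2))
    (Subtype.instMeasurableSpace.prod (𝓕 (t : ℝ≥0)))

/-- The predictable σ-field on `[0, T] × Ω`. -/
@[reducible] def predictableSigma (𝓕 : Filtration ℝ≥0 mΩ) (T : ℝ≥0) : MeasurableSpace (Set.Iic T × Ω) :=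
  𝓕.predictable.comap (fun z : Set.Iic T × Ω => ((z.1 : ℝ≥0), z.2))

/-- `G : [0, T] × Ω × V → Y` is measurable with respect to the product of the progressive σ-field
and the Borel σ-field of `V`. -/
def ProgressivelyMeasurableCoeff {V Y : Type*} [MeasurableSpace V] [MeasurableSpace Y]
    (𝓕 : Filtration ℝ≥0 mΩ) (T : ℝ≥0) (G : ℝ≥0 → Ω → V → Y) : Prop :=
  Measurable[(progressiveSigma 𝓕 T).prod inferInstance]
    (fun z : (Set.Iic T × Ω) × V => G z.1.1 z.1.2 z.2)

/-- `G : [0, T] × Ω × V × E → Y` is measurable with respect to the product of the predictable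
σ-field and the Borel σ-fields of `V` and `E`. -/
def PredictableCoeff {V E Y : Type*} [MeasurableSpace V] [MeasurableSpace E] [MeasurableSpace Y]
    (𝓕 : Filtration ℝ≥0 mΩ) (T : ℝ≥0) (G : ℝ≥0 → Ω → V → E → Y) : Prop :=
  Measurable[((predictableSigma 𝓕 T).prod inferInstance).prod inferInstance]
    (fun z : ((Set.Iic T × Ω) × V) × E => G z.1.1.1 z.1.1.2 z.1.2 z.2)

/-- `W` is an `𝓕`-adapted cylindrical Wiener process on `[0, T]` in the Hilbert space `U`, whose
increments are independent of the past; `W t h` stands for `(W_t, h)_U`. -/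
structure IsCylindricalWiener {U : Type*} [NormedAddCommGroup U] [InnerProductSpace ℝ U]
    (P : Measure Ω) (𝓕 : Filtration ℝ≥0 mΩ) (T : ℝ≥0) (W : ℝ≥0 → U → Ω → ℝ) : Prop where
  adapted : ∀ t ≤ T, ∀ h, Measurable[𝓕 t] (W t h)
  zero : ∀ h, ∀ᵐ ω ∂P, W 0 h ω = 0
  linear : ∀ t ≤ T, ∀ (a b : ℝ) (h k : U),
    ∀ᵐ ω ∂P, W t (a • h + b • k) ω = a * W t h ω + b * W t k ω
  law : ∀ s t, s ≤ t → t ≤ T → ∀ h,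
    HasLaw (fun ω => W t h ω - W s h ω) (gaussianReal 0 ((t - s) * ‖h‖₊ ^ 2)) P
  indep : ∀ s t, s ≤ t → t ≤ T →
    Indep (⨆ h : U, MeasurableSpace.comap (fun ω => W t h ω - W s h ω) inferInstance) (𝓕 s) P
  continuous : ∀ h, ∀ᵐ ω ∂P, ContinuousOn (fun t => W t h ω) (Set.Iic T)

/-- `N` is an `𝓕`-adapted time homogeneous Poisson random measure on `[0, T] × E` with intensity
`dt ⊗ ν`, such that `N((s, t], ·)` is independent of `𝓕 s`. -/
structure IsPoissonRandomMeasure {E : Type*} [MeasurableSpace E] (P : Measure Ω)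
    (𝓕 : Filtration ℝ≥0 mΩ) (T : ℝ≥0) (ν : Measure E) (N : Ω → Measure (ℝ≥0 × E)) : Prop where
  adapted : ∀ t ≤ T, ∀ S, MeasurableSet S → S ⊆ Set.Iic t ×ˢ Set.univ →
    Measurable[𝓕 t] (fun ω => N ω S)
  law : ∀ S, MeasurableSet S → S ⊆ Set.Iic T ×ˢ Set.univ → (timeMeasure.prod ν) S ≠ ∞ →
    HasLaw (fun ω => N ω S)
      ((poissonMeasure ((timeMeasure.prod ν) S).toNNReal).map (fun n : ℕ => (n : ℝ≥0∞))) P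
  indep : ∀ (n : ℕ) (S : Fin n → Set (ℝ≥0 × E)), (∀ i, MeasurableSet (S i)) →
    (∀ i, S i ⊆ Set.Iic T ×ˢ Set.univ) → Pairwise (Function.onFun Disjoint S) →
    iIndepFun (fun i ω => N ω (S i)) P
  indep_past : ∀ s t, s ≤ t → t ≤ T →
    Indep (⨆ S ∈ {S : Set (ℝ≥0 × E) | MeasurableSet S ∧ S ⊆ Set.Ioc s t ×ˢ Set.univ},
      MeasurableSpace.comap (fun ω => N ω S) inferInstance) (𝓕 s) P

/-- The cylindrical Wiener process `W` and the random measure `N` (both on `[0, T]`) are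
independent. -/
def NoisesIndependent {U E : Type*} [MeasurableSpace E] (P : Measure Ω) (T : ℝ≥0)
    (W : ℝ≥0 → U → Ω → ℝ) (N : Ω → Measure (ℝ≥0 × E)) : Prop :=
  Indep (⨆ t ∈ Set.Iic T, ⨆ h : U, MeasurableSpace.comap (W t h) inferInstance)
    (⨆ S ∈ {S : Set (ℝ≥0 × E) | MeasurableSet S ∧ S ⊆ Set.Iic T ×ˢ Set.univ},
      MeasurableSpace.comap (fun ω => N ω S) inferInstance) P

end Filtration

/-! ### The conditions on the coefficients -/

section Conditions

variable {V H Y E Ω : Type*} [NormedAddCommGroup V] [NormedSpace ℝ V]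
  [NormedAddCommGroup H] [NormedAddCommGroup Y] [MeasurableSpace E] {mΩ : MeasurableSpace Ω}

/-- Nonnegative integrable function on `[0, T]`. -/
def NonnegIntegrable (T : ℝ≥0) (K : ℝ≥0 → ℝ) : Prop :=
  (∀ t ≤ T, 0 ≤ K t) ∧ IntegrableOn K (Set.Iic T) timeMeasure

/-- Positive integrable function on `[0, T]`. -/
def PosIntegrable (T : ℝ≥0) (K : ℝ≥0 → ℝ) : Prop :=
  (∀ t ≤ T, 0 < K t) ∧ IntegrableOn K (Set.Iic T) timeMeasure

/-- Monotonicity of `(A, B, F)`. The integral over `E` is required to be finite, which is part of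
the meaning of the inequality. -/
def MonotonicityCondition (P : Measure Ω) (T : ℝ≥0) (ν : Measure E)
    (A : ℝ≥0 → Ω → V → StrongDual ℝ V) (B : ℝ≥0 → Ω → V → Y) (F : ℝ≥0 → Ω → V → E → H) : Prop :=
  ∀ᵐ ω ∂P, ∀ x y : V, ∀ t ≤ T,
    Integrable (fun ξ => ‖F t ω x ξ - F t ω y ξ‖ ^ 2) ν ∧
    2 * (A t ω x - A t ω y) (x - y) + ‖B t ω x - B t ω y‖ ^ 2
      + ∫ ξ, ‖F t ω x ξ - F t ω y ξ‖ ^ 2 ∂ν ≤ 0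

/-- Coercivity of `(A, B, F)`, with respect to the embedding `j : V → H`. The integral over `E` is
required to be finite, which is part of the meaning of the inequality. -/
def CoercivityCondition (j : V → H) (P : Measure Ω) (T : ℝ≥0) (ν : Measure E) (p : ℝ)
    (lam K₁ K₁' : ℝ≥0 → ℝ)
    (A : ℝ≥0 → Ω → V → StrongDual ℝ V) (B : ℝ≥0 → Ω → V → Y) (F : ℝ≥0 → Ω → V → E → H) : Prop :=
  ∀ᵐ ω ∂P, ∀ x : V, ∀ t ≤ T,
    Integrable (fun ξ => ‖F t ω x ξ‖ ^ 2) ν ∧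
    2 * A t ω x x + ‖B t ω x‖ ^ 2 + ∫ ξ, ‖F t ω x ξ‖ ^ 2 ∂ν + lam t * ‖x‖ ^ p
      ≤ K₁ t + K₁' t * ‖j x‖ ^ 2

/-- Growth condition on `A`. -/
def GrowthCondition (P : Measure Ω) (T : ℝ≥0) (p q : ℝ) (lam K₂ : ℝ≥0 → ℝ)
    (A : ℝ≥0 → Ω → V → StrongDual ℝ V) : Prop :=
  ∃ α : ℝ, 1 ≤ α ∧ ∀ᵐ ω ∂P, ∀ x : V, ∀ t ≤ T,
    ‖A t ω x‖ ^ q ≤ α * lam t ^ q * ‖x‖ ^ p + K₂ t * lam t ^ (q - 1)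

/-- Hemicontinuity of `A`. -/
def HemicontinuityCondition (P : Measure Ω) (T : ℝ≥0)
    (A : ℝ≥0 → Ω → V → StrongDual ℝ V) : Prop :=
  ∀ᵐ ω ∂P, ∀ x y z : V, ∀ t ≤ T,
    Tendsto (fun ε : ℝ => A t ω (x + ε • y) z) (𝓝[≠] 0) (𝓝 (A t ω x z))

end Conditions

/-! ### Discretizations -/

section Discretization

/-- The embedding `H ≅ H* → V*` of the Gelfand triple: `h ↦ (h, j ·)_H`. -/
def pivot {V H : Type*} [NormedAddCommGroup V] [NormedSpace ℝ V] [NormedAddCommGroup H]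
    [InnerProductSpace ℝ H] (j : V →L[ℝ] H) (h : H) : StrongDual ℝ V :=
  (innerSL ℝ h).comp j

/-- An increasing sequence `V₁ ⊆ V₂ ⊆ ⋯` of finite dimensional subspaces of `V` with dense union,
with nested bases that are orthonormal in `H`. -/
structure SpaceDiscretization {V H : Type*} [NormedAddCommGroup V] [NormedSpace ℝ V]
    [NormedAddCommGroup H] [InnerProductSpace ℝ H] (j : V →L[ℝ] H) where
  space : ℕ → Submodule ℝ V
  basis : ℕ → Finset V
  space_mono : Monotone space
  dense : Dense (⋃ n, (space n : Set V))
  basis_mono : Monotone basis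
  span_basis : ∀ n, Submodule.span ℝ (basis n : Set V) = space n
  orthonormal : ∀ n, Orthonormal ℝ (fun e : basis n => j (e : V))

/-- The projection `Π_n x = ∑ₖ ⟨eₖ, x⟩ eₖ` of `x ∈ V*` to the span `V_n` of the (in `H`
orthonormal) basis `b = {eₖ}`. -/
def galerkinProj {V : Type*} [NormedAddCommGroup V] [NormedSpace ℝ V]
    (b : Finset V) (x : StrongDual ℝ V) : V := ∑ e ∈ b, x e • e

/-- An increasing sequence `E¹ ⊆ E² ⊆ ⋯` of compact subsets of `E` of finite `ν`-measure with union
`E` (with the convention `E⁰ = ∅`), and, for every `l`, a finite measurable partition of `E^l` which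
is finer than `{E¹, E² \ E¹, …, E^l \ E^(l-1)}` and whose cells have diameter less than `ε_l`, where
`ε_l ↓ 0`. -/
structure JumpDiscretization {E : Type*} [MetricSpace E] [MeasurableSpace E]
    (ν : Measure E) where
  exhaust : ℕ → Set E
  exhaust_zero : exhaust 0 = ∅
  exhaust_mono : Monotone exhaust
  exhaust_compact : ∀ l, IsCompact (exhaust l)
  exhaust_finite : ∀ l, ν (exhaust l) < ∞
  exhaust_iUnion : ⋃ l, exhaust l = Set.univ
  r : ℕ → ℕ
  cell : (l : ℕ) → Fin (r l) → Set E
  cell_measurable : ∀ l i, MeasurableSet (cell l i)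
  cell_disjoint : ∀ l, Pairwise (Function.onFun Disjoint (cell l))
  cell_iUnion : ∀ l, ⋃ i, cell l i = exhaust l
  cell_finer : ∀ l i, ∃ k < l, cell l i ⊆ exhaust (k + 1) \ exhaust k
  ε : ℕ → ℝ
  ε_anti : Antitone ε
  ε_tendsto : Tendsto ε atTop (𝓝 0)
  cell_diam : ∀ l i, Metric.diam (cell l i) < ε l

/-- The grid point `t_i = i T / m`. -/
def gridPt (T : ℝ≥0) (m i : ℕ) : ℝ≥0 := i * (T / m)

/-- The step size `δ_m = T / m`. -/
def stepSize (T : ℝ≥0) (m : ℕ) : ℝ := (T : ℝ) / m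

/-- `W^l_t = ∑_{k ≤ l} (W_t, g_k)_U g_k`, the projection of the cylindrical Wiener process to the
span of the first `l` elements of an orthonormal basis of `U`. The basis consists of `d ≤ ∞`
elements, numbered from `0`. -/
def truncatedWiener {U Ω : Type*} [NormedAddCommGroup U] [InnerProductSpace ℝ U] {d : ℕ∞}
    (g : HilbertBasis {k : ℕ // (k : ℕ∞) < d} ℝ U) (W : ℝ≥0 → U → Ω → ℝ) (l : ℕ)
    (t : ℝ≥0) (ω : Ω) : U :=
  ∑ k ∈ Finset.range l, if h : (k : ℕ∞) < d then W t (g ⟨k, h⟩) ω • g ⟨k, h⟩ else 0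

/-- The pathwise integral `∫_E f(ξ) Ñ((s, t], dξ)` with respect to the compensated measure
`Ñ = N - dt ⊗ ν`, for `f` integrable with respect to both parts. -/
def compensatedIntegral {E G : Type*} [MeasurableSpace E] [NormedAddCommGroup G] [NormedSpace ℝ G]
    (ν : Measure E) (N : Measure (ℝ≥0 × E)) (s t : ℝ≥0) (f : E → G) : G :=
  (∫ z in Set.Ioc s t ×ˢ Set.univ, f z.2 ∂N)
    - ∫ z in Set.Ioc s t ×ˢ Set.univ, f z.2 ∂(timeMeasure.prod ν)

variable {V Y H E Ω : Type*}

/-- The mean of a coefficient over the current subinterval: `A^m_{t_i}` for `i ≥ 1`, and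
`A^m_{t_0} = 0`. -/
def currentMean [NormedAddCommGroup Y] [NormedSpace ℝ Y] (T : ℝ≥0) (m : ℕ)
    (A : ℝ≥0 → Ω → V → Y) (i : ℕ) (ω : Ω) (x : V) : Y :=
  if i = 0 then 0
  else (stepSize T m)⁻¹ •
    ∫ s in Set.Ioc (gridPt T m (i - 1)) (gridPt T m i), A s ω x ∂timeMeasure

/-- The mean of a coefficient over the preceding subinterval: `B̃^m_{t_i}` for `i ≥ 2`, and
`B̃^m_{t_0} = B̃^m_{t_1} = 0`. -/
def precedingMean [NormedAddCommGroup Y] [NormedSpace ℝ Y] (T : ℝ≥0) (m : ℕ)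
    (B : ℝ≥0 → Ω → V → Y) (i : ℕ) (ω : Ω) (x : V) : Y :=
  if i ≤ 1 then 0
  else (stepSize T m)⁻¹ •
    ∫ s in Set.Ioc (gridPt T m (i - 2)) (gridPt T m (i - 1)), B s ω x ∂timeMeasure

/-- The discretized jump coefficient `F̃^{m,l}_{t_i}(x, ξ)`: for `i ≥ 2` the mean of `F` over the
preceding subinterval and the cell of `ξ`; it vanishes for `ξ ∉ E^l` and for `i ≤ 1`. -/
def jumpMean [NormedAddCommGroup H] [NormedSpace ℝ H] [MetricSpace E] [MeasurableSpace E]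
    {ν : Measure E} (D : JumpDiscretization ν) (T : ℝ≥0) (m l : ℕ)
    (F : ℝ≥0 → Ω → V → E → H) (i : ℕ) (ω : Ω) (x : V) (ξ : E) : H :=
  if i ≤ 1 then 0
  else ∑ k : Fin (D.r l), (D.cell l k).indicator (fun _ =>
    (stepSize T m * (ν (D.cell l k)).toReal)⁻¹ •
      ∫ s in Set.Ioc (gridPt T m (i - 2)) (gridPt T m (i - 1)),
        (∫ η in D.cell l k, F s ω x η ∂ν) ∂timeMeasure) ξ

end Discretization

/-! ### The implicit schemes -/

section Schemes

variable {V H U E Ω : Type*} [NormedAddCommGroup V] [NormedSpace ℝ V]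
  [NormedAddCommGroup H] [InnerProductSpace ℝ H] [NormedAddCommGroup U] [InnerProductSpace ℝ U]
  [MetricSpace E] [MeasurableSpace E] {mΩ : MeasurableSpace Ω} {d : ℕ∞}

/-- `u 1, …, u m : Ω → V` solve almost surely the implicit scheme without projection, an equation
in `V*`. The initial value `ζ` is only `H`-valued, so the value `u 0` is not used (for `i = 1` the
noise terms vanish since `B̃^m_{t_1} = 0` and `F̃^{m,l}_{t_1} = 0`). -/
def SolvesImplicit (P : Measure Ω) (T : ℝ≥0) (j : V →L[ℝ] H)
    (g : HilbertBasis {k : ℕ // (k : ℕ∞) < d} ℝ U) {ν : Measure E} (D : JumpDiscretization ν)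
    (W : ℝ≥0 → U → Ω → ℝ) (N : Ω → Measure (ℝ≥0 × E))
    (A : ℝ≥0 → Ω → V → StrongDual ℝ V) (B : ℝ≥0 → Ω → V → HilbertSchmidt g H)
    (F : ℝ≥0 → Ω → V → E → H) (ζ : Ω → H) (m l : ℕ) (u : ℕ → Ω → V) : Prop :=
  ∀ i, 1 ≤ i → i ≤ m → ∀ᵐ ω ∂P,
    pivot j (j (u i ω)) =
      pivot j (if i = 1 then ζ ω else j (u (i - 1) ω))
      + stepSize T m • currentMean T m A i ω (u i ω)
      + pivot j ((precedingMean T m B i ω (u (i - 1) ω)).toCLM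
          (truncatedWiener g W l (gridPt T m i) ω - truncatedWiener g W l (gridPt T m (i - 1)) ω))
      + pivot j (compensatedIntegral ν (N ω) (gridPt T m (i - 1)) (gridPt T m i)
          (jumpMean D T m l F i ω (u (i - 1) ω)))

/-- `u 0, …, u m : Ω → V` solve almost surely the implicit scheme projected to `V_n`. -/
def SolvesProjectedImplicit (P : Measure Ω) (T : ℝ≥0) (j : V →L[ℝ] H)
    (G : SpaceDiscretization j)
    (g : HilbertBasis {k : ℕ // (k : ℕ∞) < d} ℝ U) {ν : Measure E} (D : JumpDiscretization ν)
    (W : ℝ≥0 → U → Ω → ℝ) (N : Ω → Measure (ℝ≥0 × E))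
    (A : ℝ≥0 → Ω → V → StrongDual ℝ V) (B : ℝ≥0 → Ω → V → HilbertSchmidt g H)
    (F : ℝ≥0 → Ω → V → E → H) (ζ : Ω → H) (n m l : ℕ) (u : ℕ → Ω → V) : Prop :=
  (∀ᵐ ω ∂P, u 0 ω = galerkinProj (G.basis n) (pivot j (ζ ω))) ∧
  ∀ i, 1 ≤ i → i ≤ m → ∀ᵐ ω ∂P,
    u i ω = u (i - 1) ω
      + stepSize T m • galerkinProj (G.basis n) (currentMean T m A i ω (u i ω))
      + galerkinProj (G.basis n) (pivot j ((precedingMean T m B i ω (u (i - 1) ω)).toCLM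
          (truncatedWiener g W l (gridPt T m i) ω - truncatedWiener g W l (gridPt T m (i - 1)) ω)))
      + compensatedIntegral ν (N ω) (gridPt T m (i - 1)) (gridPt T m i) (fun ξ =>
          galerkinProj (G.basis n) (pivot j (jumpMean D T m l F i ω (u (i - 1) ω) ξ)))

end Schemes

end

/-!
Each equation of the scheme is an equation `D x = h` for the operator
`D x = x - ∫ A_s(x) ds` from `V` to `V*`, the integral being over the current time step, with a
right side `h` in `H` that is known from the preceding steps. Monotonicity of `A` gives
`⟨D x - D y, x - y⟩ ≥ ‖x - y‖²` in the norm of `H`, hence uniqueness, and if the integral of `K₁'`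
over the step is at most one (which holds on all sufficiently fine grids), then coercivity gives
`2 ⟨D x - h, x⟩ ≥ (∫ lam) ‖x‖ ^ p - ∫ K₁ - ‖h‖²`. This serves twice: it makes `D` coercive, and it
bounds the `p`-th moment of the solution in `V` by the second moment of `h` in `H`.

Existence is the Minty-Browder theorem (`IsMonotoneHemicontinuous.exists_apply_eq`), proved without
fixed point theorems: finitely many inequalities `⟨D z - h, z - x⟩ ≥ 0` have a common solution in
the convex hull of the test points by a separation argument (`exists_mem_convexHull_forall_nonneg`), all
of them have one in a ball by weak compactness, and hemicontinuity turns them into the equation.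

The same inequalities, tested on a countable dense set only, give measurability of the solution
(`IsMonotoneHemicontinuous.measurable_solution`): whether the solution lies in a given closed ball
is decided by countably many measurable conditions. Square integrability of the noise terms follows
from independence of the increments from the past and the pathwise growth bounds of the
coefficients (`IsRegularPath`), so that the scheme can be solved step by step
(`exists_unique_implicit_scheme`).

Density of the embedding is not needed for this, so the result applies to the finite dimensional
space `V_n` with the restricted coefficients. As two functionals have the same projection by `Π_n`
iff they agree on `V_n`, the scheme obtained there is the projected one
(`projected_equation_iff`, `exists_unique_projected_scheme`).
-/

/-! ### Weak compactness and separability in reflexive spaces -/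

section Reflexive

variable {V : Type*} [NormedAddCommGroup V] [NormedSpace ℝ V]

/-- Weak compactness of closed balls of a reflexive space, stated for families of half spaces: if
finitely many of them always meet in the ball, then all of them do. -/
theorem exists_mem_closedBall_forall_le_of_finset
    (hrefl : Function.Surjective (NormedSpace.inclusionInDoubleDual ℝ V))
    {ι : Type*} (c : V) (R : ℝ) (f : ι → StrongDual ℝ V) (a : ι → ℝ)
    (h : ∀ s : Finset ι, ∃ x ∈ Metric.closedBall c R, ∀ i ∈ s, a i ≤ f i x) :
    ∃ x ∈ Metric.closedBall c R, ∀ i, a i ≤ f i x := by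
  let J := NormedSpace.inclusionInDoubleDualLi (E := V) ℝ
  have hK := WeakDual.isCompact_closedBall (𝕜 := ℝ) (E := StrongDual ℝ V) (J c) R
  have hcl : ∀ i, IsClosed {Φ : WeakDual ℝ (StrongDual ℝ V) | a i ≤ Φ (f i)} := fun i =>
    isClosed_le continuous_const (WeakDual.eval_continuous (f i))
  have hmem : ∀ x : V, x ∈ Metric.closedBall c R ↔ J x ∈ Metric.closedBall (J c) R := fun x => by
    rw [Metric.mem_closedBall, Metric.mem_closedBall, J.dist_map]
  obtain ⟨Φ, hΦ, hΦ'⟩ := hK.inter_iInter_nonempty _ hcl fun s => by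
    obtain ⟨x, hx, hxs⟩ := h s
    refine ⟨StrongDual.toWeakDual (J x), (hmem x).1 hx, ?_⟩
    simp only [Set.mem_iInter, Set.mem_ofPred_eq]
    exact hxs
  obtain ⟨x, hx⟩ := hrefl (WeakDual.toStrongDual Φ)
  refine ⟨x, (hmem x).2 ?_, fun i => ?_⟩
  · change NormedSpace.inclusionInDoubleDual ℝ V x ∈ _
    rw [hx]
    exact hΦ
  · have h1 : NormedSpace.inclusionInDoubleDual ℝ V x (f i) = Φ (f i) := by rw [hx]; rfl
    rw [NormedSpace.dual_def] at h1
    rw [h1]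
    exact Set.mem_iInter.1 hΦ' i

/-- A normed space with separable dual is separable: the span of vectors that almost norm a dense
sequence of functionals is dense. -/
theorem separableSpace_of_separableSpace_strongDual
    [TopologicalSpace.SeparableSpace (StrongDual ℝ V)] : TopologicalSpace.SeparableSpace V := by
  have hex : ∀ f : StrongDual ℝ V, ∃ x : V, ‖x‖ ≤ 1 ∧ ‖f‖ / 2 ≤ f x := by
    intro f
    rcases eq_or_ne f 0 with rfl | hf
    · exact ⟨0, by simp⟩
    obtain ⟨x, hx, hfx⟩ := f.exists_lt_apply_of_lt_opNorm
      (half_lt_self (norm_pos_iff.2 hf))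
    rw [Real.norm_eq_abs] at hfx
    rcases abs_cases (f x) with h | h
    · exact ⟨x, hx.le, by linarith⟩
    · exact ⟨-x, by simpa using hx.le, by rw [map_neg]; linarith⟩
  choose x hx1 hx2 using hex
  let s : Set V := Set.range fun n => x (TopologicalSpace.denseSeq (StrongDual ℝ V) n)
  let S : Submodule ℝ V := (Submodule.span ℝ s).topologicalClosure
  have hsep : TopologicalSpace.IsSeparable (S : Set V) := by
    rw [Submodule.topologicalClosure_coe]
    exact ((Set.countable_range _).isSeparable.span (R := ℝ)).closure
  have htop : (S : Set V) = Set.univ := by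
    by_contra hne
    obtain ⟨z, hz⟩ := (Set.ne_univ_iff_exists_notMem _).1 hne
    obtain ⟨f, u, hfu, huz⟩ := geometric_hahn_banach_closed_point S.convex
      (Submodule.isClosed_topologicalClosure _) hz
    have hf0 : ∀ y ∈ S, f y = 0 := by
      intro y hy
      by_contra hfy
      have h1 := hfu (((u + 1) / f y) • y) (S.smul_mem _ hy)
      rw [map_smul, smul_eq_mul, div_mul_cancel₀ _ hfy] at h1
      linarith
    have hfne : 0 < ‖f‖ := by
      refine norm_pos_iff.2 fun h0 => ?_
      have h1 := hfu 0 S.zero_mem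
      rw [h0] at h1 huz
      simp at h1 huz
      linarith
    obtain ⟨n, hn⟩ := (TopologicalSpace.denseRange_denseSeq (StrongDual ℝ V)).exists_dist_lt f
      (show 0 < ‖f‖ / 4 by positivity)
    set f' := TopologicalSpace.denseSeq (StrongDual ℝ V) n
    have h1 : f (x f') = 0 := hf0 _ (Submodule.le_topologicalClosure _
      (Submodule.subset_span ⟨n, rfl⟩))
    have h2 := hx2 f'
    have h3 : f' (x f') ≤ ‖f' - f‖ := by
      have h4 := (f' - f).le_opNorm (x f')
      rw [sub_apply, h1, sub_zero] at h4
      exact (le_abs_self _).trans (h4.trans (mul_le_of_le_one_right (norm_nonneg _) (hx1 _)))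
    rw [dist_eq_norm, norm_sub_rev] at hn
    have h5 : ‖f‖ ≤ ‖f'‖ + ‖f' - f‖ := by
      have := norm_sub_le f' (f' - f)
      simpa using this
    linarith
  rw [htop] at hsep
  exact TopologicalSpace.isSeparable_univ_iff.1 hsep

theorem separableSpace_strongDual_of_reflexive [TopologicalSpace.SeparableSpace V]
    (hrefl : Function.Surjective (NormedSpace.inclusionInDoubleDual ℝ V)) :
    TopologicalSpace.SeparableSpace (StrongDual ℝ V) := by
  have : TopologicalSpace.SeparableSpace (StrongDual ℝ (StrongDual ℝ V)) :=
    hrefl.denseRange.separableSpace (NormedSpace.inclusionInDoubleDual ℝ V).continuous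
  exact separableSpace_of_separableSpace_strongDual

theorem surjective_inclusionInDoubleDual_of_finiteDimensional [FiniteDimensional ℝ V] :
    Function.Surjective (NormedSpace.inclusionInDoubleDual ℝ V) := by
  have hinj : Function.Injective (NormedSpace.inclusionInDoubleDual ℝ V).toLinearMap :=
    (NormedSpace.inclusionInDoubleDualLi (E := V) ℝ).injective
  have hd : Module.finrank ℝ V = Module.finrank ℝ (StrongDual ℝ (StrongDual ℝ V)) := by
    have h (X : Type _) [NormedAddCommGroup X] [NormedSpace ℝ X] [FiniteDimensional ℝ X] :
        Module.finrank ℝ (StrongDual ℝ X) = Module.finrank ℝ X := by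
      rw [← (LinearMap.toContinuousLinearMap (𝕜 := ℝ) (E := X) (F' := ℝ)).finrank_eq]
      exact Subspace.dual_finrank_eq
    have : FiniteDimensional ℝ (StrongDual ℝ V) :=
      (LinearMap.toContinuousLinearMap (𝕜 := ℝ) (E := V) (F' := ℝ)).finiteDimensional
    rw [h, h]
  have : FiniteDimensional ℝ (StrongDual ℝ V) :=
      (LinearMap.toContinuousLinearMap (𝕜 := ℝ) (E := V) (F' := ℝ)).finiteDimensional
  have : FiniteDimensional ℝ (StrongDual ℝ (StrongDual ℝ V)) :=
      (LinearMap.toContinuousLinearMap (𝕜 := ℝ) (E := StrongDual ℝ V) (F' := ℝ)).finiteDimensional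
  exact (LinearMap.injective_iff_surjective_of_finrank_eq_finrank hd).1 hinj

end Reflexive

/-! ### Monotone hemicontinuous operators -/

section Monotone

variable {V : Type*} [NormedAddCommGroup V] [NormedSpace ℝ V]

/-- Minty's lemma for finite families: for a finite monotone family of pairs `(xᵢ, fᵢ)` the system
`⟨fᵢ, xᵢ - z⟩ ≥ 0` has a solution in the convex hull of the `xᵢ`. Otherwise a hyperplane would
separate the values `(⟨fᵢ, xᵢ - z⟩)ᵢ` from the positive cone, and its normal vector `w ≥ 0` would
give `∑ᵢₖ wᵢ wₖ ⟨fᵢ, xᵢ - xₖ⟩ < 0`, against monotonicity. -/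
theorem exists_mem_convexHull_forall_nonneg {ι : Type*} [Fintype ι] [Nonempty ι]
    (x : ι → V) (f : ι → StrongDual ℝ V) (hmono : ∀ i k, 0 ≤ (f i - f k) (x i - x k)) :
    ∃ z ∈ convexHull ℝ (Set.range x), ∀ i, 0 ≤ f i (x i - z) := by
  classical
  let Φ : (ι → ℝ) →ₗ[ℝ] V := Fintype.linearCombination ℝ x
  have hΦ : ∀ w, Φ w = ∑ k, w k • x k := fun w => Fintype.linearCombination_apply ℝ x w
  let L : (ι → ℝ) →ₗ[ℝ] (ι → ℝ) := LinearMap.pi fun i => (f i).toLinearMap ∘ₗ Φ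
  have hL : ∀ w i, L w i = f i (Φ w) := fun w i => rfl
  let s : Set (ι → ℝ) := (fun v => (fun i => f i (x i)) - v) '' (L '' stdSimplex ℝ ι)
  have hs1 : Convex ℝ s := by
    rintro _ ⟨_, ⟨w, hw, rfl⟩, rfl⟩ _ ⟨_, ⟨w', hw', rfl⟩, rfl⟩ a b ha hb hab
    refine ⟨_, ⟨a • w + b • w', convex_stdSimplex ℝ ι hw hw' ha hb hab, rfl⟩, funext fun i => ?_⟩
    obtain rfl : a = 1 - b := by linarith
    simp only [map_add, map_smul, Pi.sub_apply, Pi.add_apply, Pi.smul_apply, smul_eq_mul]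
    ring
  have hs2 : IsCompact s :=
    ((isCompact_stdSimplex ℝ ι).image L.continuous_of_finiteDimensional).image (by fun_prop)
  let t : Set (ι → ℝ) := {c | ∀ i, 0 ≤ c i}
  have ht1 : Convex ℝ t := fun a ha b hb p q hp hq _ i => by
    simp only [Pi.add_apply, Pi.smul_apply, smul_eq_mul]
    exact add_nonneg (mul_nonneg hp (ha i)) (mul_nonneg hq (hb i))
  have ht2 : IsClosed t := by
    simp only [t, Set.ofPred_forall]
    exact isClosed_iInter fun i => isClosed_le continuous_const (continuous_apply i)
  by_cases hdis : Disjoint s t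
  · exfalso
    obtain ⟨φ, u, v, hφs, huv, hφt⟩ := geometric_hahn_banach_compact_closed hs1 hs2 ht1 ht2 hdis
    have hv0 : v < 0 := by
      have := hφt 0 (fun i => le_rfl)
      simpa using this
    let w : ι → ℝ := fun i => φ (Pi.single i 1)
    have hφw : ∀ c, φ c = ∑ i, c i * w i := fun c => by
      conv_lhs => rw [pi_eq_sum_univ' c]
      simp [w, map_sum, map_smul]
    have hw : ∀ i, 0 ≤ w i := by
      intro i
      by_contra hneg
      have hneg' : w i < 0 := not_le.1 hneg
      have h1 := hφt ((v / w i) • Pi.single i 1) (fun k => by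
        simp only [Pi.smul_apply, smul_eq_mul]
        refine mul_nonneg (div_nonneg_of_nonpos hv0.le hneg'.le) ?_
        rw [Pi.single_apply]; split_ifs <;> norm_num)
      rw [map_smul, smul_eq_mul] at h1
      change v < v / w i * w i at h1
      rw [div_mul_cancel₀ _ hneg'.ne] at h1
      exact lt_irrefl _ h1
    have hW : 0 < ∑ i, w i := by
      refine lt_of_le_of_ne (Finset.sum_nonneg fun i _ => hw i) fun h0 => ?_
      have h0' : ∀ i, w i = 0 := fun i =>
        (Finset.sum_eq_zero_iff_of_nonneg fun i _ => hw i).1 h0.symm i (Finset.mem_univ i)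
      have h1 := hφs _ ⟨_, ⟨_, single_mem_stdSimplex ℝ (Classical.arbitrary ι), rfl⟩, rfl⟩
      rw [hφw] at h1
      simp only [h0', mul_zero, Finset.sum_const_zero] at h1
      linarith
    let w' : ι → ℝ := fun i => (∑ i, w i)⁻¹ * w i
    have hw' : w' ∈ stdSimplex ℝ ι :=
      ⟨fun i => mul_nonneg (inv_nonneg.2 hW.le) (hw i), by
        rw [← Finset.mul_sum, inv_mul_cancel₀ hW.ne']⟩
    have h1 := hφs _ ⟨_, ⟨_, hw', rfl⟩, rfl⟩
    rw [hφw] at h1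
    have h2 : ∑ i, ((fun i => f i (x i)) - L w') i * w i
        = (∑ i, w i)⁻¹ * ∑ i, ∑ k, w i * w k * f i (x i - x k) := by
      rw [Finset.mul_sum]
      refine Finset.sum_congr rfl fun i _ => ?_
      have h3 : f i (x i) = ∑ k, w' k * f i (x i) := by rw [← Finset.sum_mul, hw'.2, one_mul]
      rw [Pi.sub_apply, hL, hΦ, map_sum, h3, ← Finset.sum_sub_distrib, Finset.sum_mul,
        Finset.mul_sum]
      refine Finset.sum_congr rfl fun k _ => ?_
      simp only [map_smul, map_sub, smul_eq_mul, w']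
      ring
    have h3 : 0 ≤ ∑ i, ∑ k, w i * w k * f i (x i - x k) := by
      have h4 : ∑ i, ∑ k, w i * w k * f i (x i - x k)
          = ∑ i, ∑ k, w i * w k * f k (x k - x i) := by
        rw [Finset.sum_comm]
        exact Finset.sum_congr rfl fun i _ => Finset.sum_congr rfl fun k _ => by ring
      have h5 : 0 ≤ ∑ i, ∑ k, w i * w k * (f i - f k) (x i - x k) :=
        Finset.sum_nonneg fun i _ => Finset.sum_nonneg fun k _ =>
          mul_nonneg (mul_nonneg (hw i) (hw k)) (hmono i k)
      have h6 : ∑ i, ∑ k, w i * w k * (f i - f k) (x i - x k)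
          = ∑ i, ∑ k, w i * w k * f i (x i - x k) + ∑ i, ∑ k, w i * w k * f k (x k - x i) := by
        simp_rw [← Finset.sum_add_distrib]
        refine Finset.sum_congr rfl fun i _ => Finset.sum_congr rfl fun k _ => ?_
        simp only [sub_apply, map_sub]
        ring
      linarith
    have h4 := mul_nonneg (inv_nonneg.2 hW.le) h3
    linarith
  · obtain ⟨_, ⟨_, ⟨w, hw, rfl⟩, rfl⟩, hc⟩ := Set.not_disjoint_iff.1 hdis
    refine ⟨Φ w, ?_, fun i => ?_⟩
    · rw [hΦ]
      exact (convex_convexHull ℝ _).sum_mem (fun i _ => hw.1 i) hw.2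
        fun i _ => subset_convexHull ℝ _ ⟨i, rfl⟩
    · have h1 : 0 ≤ f i (x i) - f i (Φ w) := hc i
      rwa [map_sub]

/-- `D : V → V*` is monotone, hemicontinuous (along rays, tested against the direction of the ray)
and bounded on balls. -/
structure IsMonotoneHemicontinuous (D : V → StrongDual ℝ V) : Prop where
  mono : ∀ x y, 0 ≤ (D x - D y) (x - y)
  hemi : ∀ x w, Tendsto (fun ε : ℝ => D (x + ε • w) w) (𝓝[>] 0) (𝓝 (D x w))
  bdd : ∀ R : ℝ, ∃ C : ℝ, ∀ x, ‖x‖ ≤ R → ‖D x‖ ≤ C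

namespace IsMonotoneHemicontinuous

variable {D : V → StrongDual ℝ V}

/-- The Minty-Browder theorem. By the finite version of Minty's lemma and weak compactness there is
`x` in the ball with `⟨D z - y, z - x⟩ ≥ 0` for all `z` in the ball; hemicontinuity turns this into
a variational inequality for `D x`, and the sign condition on the sphere puts `x` into the
interior. -/
theorem exists_apply_eq (hD : IsMonotoneHemicontinuous D)
    (hrefl : Function.Surjective (NormedSpace.inclusionInDoubleDual ℝ V))
    (y : StrongDual ℝ V) {R : ℝ} (hR : 0 ≤ R) (hcoer : ∀ x, ‖x‖ = R → 0 < (D x - y) x) :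
    ∃ x, D x = y := by
  have hball : ∀ z : V, z ∈ Metric.closedBall (0 : V) R ↔ ‖z‖ ≤ R := fun z => by
    rw [mem_closedBall_zero_iff]
  obtain ⟨x, hx, hxz⟩ := exists_mem_closedBall_forall_le_of_finset hrefl
    (ι := Metric.closedBall (0 : V) R) 0 R (fun z => -(D z - y)) (fun z => -(D z - y) z) (by
      intro s
      classical
      rcases s.eq_empty_or_nonempty with rfl | hs
      · exact ⟨0, by simpa using hR, by simp⟩
      · have : Nonempty s := hs.to_subtype
        obtain ⟨z, hz, hz'⟩ := exists_mem_convexHull_forall_nonneg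
          (fun i : s => ((i : Metric.closedBall (0 : V) R) : V)) (fun i => D i.1.1 - y)
          (fun i k => by simpa using hD.mono i.1.1 k.1.1)
        refine ⟨z, ?_, fun i hi => ?_⟩
        · refine convexHull_min ?_ (convex_closedBall 0 R) hz
          rintro _ ⟨i, rfl⟩
          exact i.1.2
        · have := hz' ⟨i, hi⟩
          simp only [map_sub] at this
          simp only [neg_apply]
          linarith)
  rw [hball] at hx
  have hvar : ∀ w, ‖w‖ ≤ R → 0 ≤ (D x - y) (w - x) := by
    intro w hw
    have hlim : Tendsto (fun ε : ℝ => (D (x + ε • (w - x)) - y) (w - x)) (𝓝[>] 0)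
        (𝓝 ((D x - y) (w - x))) := (hD.hemi x (w - x)).sub_const _
    refine ge_of_tendsto hlim ?_
    filter_upwards [Ioc_mem_nhdsGT (zero_lt_one' ℝ)] with ε hε
    have hz : x + ε • (w - x) ∈ Metric.closedBall (0 : V) R :=
      (convex_closedBall (0 : V) R).add_smul_sub_mem ((hball x).2 hx) ((hball w).2 hw)
        ⟨hε.1.le, hε.2⟩
    have h1 := hxz ⟨_, hz⟩
    have h2 : 0 ≤ (D (x + ε • (w - x)) - y) (x + ε • (w - x) - x) := by
      rw [map_sub]
      simp only [neg_apply] at h1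
      linarith
    rw [add_sub_cancel_left, map_smul, smul_eq_mul] at h2
    exact nonneg_of_mul_nonneg_right h2 hε.1
  have hlt : ‖x‖ < R := by
    refine lt_of_le_of_ne hx fun h => ?_
    have h1 := hvar 0 (by simpa using hR)
    rw [zero_sub, map_neg] at h1
    linarith [hcoer x h]
  have hpos : ∀ h : V, 0 ≤ (D x - y) h := by
    intro h
    have hev : ∀ᶠ t : ℝ in 𝓝[>] 0, ‖x + t • h‖ < R := by
      refine tendsto_nhdsWithin_of_tendsto_nhds ?_ |>.eventually (gt_mem_nhds hlt)
      have hc : Continuous fun t : ℝ => ‖x + t • h‖ := by fun_prop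
      simpa using hc.tendsto 0
    obtain ⟨t, ht, ht0⟩ := (hev.and self_mem_nhdsWithin).exists
    have h1 := hvar _ ht.le
    rw [add_sub_cancel_left, map_smul, smul_eq_mul] at h1
    exact nonneg_of_mul_nonneg_right h1 ht0
  refine ⟨x, ?_⟩
  refine sub_eq_zero.1 (ContinuousLinearMap.ext fun h => ?_)
  have h1 := hpos h
  have h2 := hpos (-h)
  rw [map_neg] at h2
  simp only [zero_apply]
  linarith

/-- Minty's trick with countably many tests: the solution of `D x = y` is characterized by
`⟨D z - y, z - x⟩ ≥ 0` for `z` in a dense set. -/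
theorem apply_eq_of_forall_denseRange (hD : IsMonotoneHemicontinuous D) {κ : Type*} {z : κ → V}
    (hz : DenseRange z) {x : V} {y : StrongDual ℝ V} (h : ∀ i, 0 ≤ (D (z i) - y) (z i - x)) :
    D x = y := by
  -- by density, `⟨D (x + s w), w⟩ ≥ ⟨y, w⟩` for every direction `w` and every `s > 0`
  have key : ∀ w : V, ∀ s > (0 : ℝ), y w ≤ D (x + s • w) w := by
    intro w s hs
    -- `D` is tested at points `z i` close to `x + t w`, and compared with `D (x + 2 t w)`
    set t := s / 2 with ht
    have ht0 : 0 < t := by positivity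
    obtain ⟨C, hC⟩ := hD.bdd (‖x + t • w‖ + 1)
    set D' := D (x + s • w) with hD'
    have hC0 : 0 ≤ C := (norm_nonneg _).trans (hC (x + t • w) (by linarith))
    refine le_of_forall_pos_le_add fun ε hε => ?_
    let M := 2 * C + ‖y‖ + ‖D'‖ + 1
    have hM : 0 < M := by positivity
    obtain ⟨i, hi⟩ := hz.exists_dist_lt (x + t • w)
      (show 0 < min 1 (t * ε / M) by positivity)
    rw [dist_comm, dist_eq_norm] at hi
    set e := z i - (x + t • w) with he
    have hzi : z i = x + t • w + e := by rw [he]; abel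
    have he1 : ‖e‖ ≤ 1 := (hi.trans_le (min_le_left _ _)).le
    have he2 : M * ‖e‖ ≤ t * ε := by
      have := (hi.trans_le (min_le_right _ _)).le
      rwa [le_div_iff₀ hM, mul_comm] at this
    have hDz : ‖D (z i)‖ ≤ C := hC _ (by
      rw [hzi]; exact (norm_add_le _ _).trans (by linarith))
    have h1 := h i
    have h2 := hD.mono (z i) (x + s • w)
    rw [← hD'] at h2
    have e1 : z i - x = t • w + e := by rw [hzi]; abel
    have e2 : z i - (x + s • w) = e - t • w := by
      rw [hzi]
      have : s • w = t • w + t • w := by rw [← add_smul]; congr 1; rw [ht]; ring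
      rw [this]; abel
    rw [e1] at h1
    rw [e2] at h2
    simp only [sub_apply, map_add, map_sub, map_smul, smul_eq_mul] at h1 h2
    have b1 : D (z i) e ≤ C * ‖e‖ := (le_abs_self _).trans
      (((D (z i)).le_opNorm e).trans (mul_le_mul_of_nonneg_right hDz (norm_nonneg _)))
    have b2 : -(y e) ≤ ‖y‖ * ‖e‖ := (neg_le_abs _).trans (y.le_opNorm e)
    have b3 : -(D' e) ≤ ‖D'‖ * ‖e‖ := (neg_le_abs _).trans (D'.le_opNorm e)
    have h3 : t * y w ≤ t * (D' w + ε) := by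
      have : (2 * C + ‖y‖ + ‖D'‖) * ‖e‖ ≤ M * ‖e‖ :=
        mul_le_mul_of_nonneg_right (by simp only [M]; linarith) (norm_nonneg _)
      nlinarith
    exact le_of_mul_le_mul_left h3 ht0
  have hle : ∀ w : V, y w ≤ D x w := fun w =>
    ge_of_tendsto (hD.hemi x w) (eventually_nhdsWithin_of_forall fun s hs => key w s hs)
  refine ContinuousLinearMap.ext fun w => le_antisymm ?_ (hle w)
  have := hle (-w)
  rw [map_neg, map_neg] at this
  linarith

end IsMonotoneHemicontinuous

end Monotone

/-! ### Measurability of the solution of a random monotone equation -/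

section MeasurableSolution

variable {V : Type*} [NormedAddCommGroup V] [NormedSpace ℝ V]

theorem measurable_of_measurableSet_preimage_closedBall {Ω X : Type*} {m : MeasurableSpace Ω}
    [PseudoMetricSpace X] [TopologicalSpace.SeparableSpace X] [MeasurableSpace X] [BorelSpace X]
    {u : Ω → X} (h : ∀ (c : X) (R : ℝ), MeasurableSet (u ⁻¹' Metric.closedBall c R)) :
    Measurable u := by
  refine measurable_of_isOpen fun O hO => ?_
  obtain ⟨s, hsc, hsd⟩ := TopologicalSpace.exists_countable_dense X
  have hO' : O = ⋃ c ∈ s, ⋃ r ∈ {r : ℚ | Metric.closedBall c (r : ℝ) ⊆ O},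
      Metric.closedBall c (r : ℝ) := by
    refine Set.Subset.antisymm (fun x hx => ?_) ?_
    · obtain ⟨ε, hε, hεO⟩ := Metric.isOpen_iff.1 hO x hx
      obtain ⟨c, hcs, hc⟩ := hsd.exists_dist_lt x (show 0 < ε / 3 by positivity)
      obtain ⟨r, hr1, hr2⟩ := exists_rat_btwn (show ε / 3 < ε / 2 by linarith)
      simp only [Set.mem_iUnion]
      refine ⟨c, hcs, r, fun z hz => hεO ?_, ?_⟩
      · rw [Metric.mem_closedBall] at hz
        rw [Metric.mem_ball]
        have := dist_triangle z c x
        rw [dist_comm c x] at this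
        linarith
      · rw [Metric.mem_closedBall]; linarith
    · exact Set.iUnion₂_subset fun c _ => Set.iUnion₂_subset fun r hr => hr
  rw [hO']
  simp only [Set.preimage_iUnion]
  exact MeasurableSet.biUnion hsc fun c _ => MeasurableSet.biUnion (Set.to_countable _)
    fun r _ => h c r

/-- Measurability of the solution of a random monotone equation. By Minty's trick and weak
compactness, the solution `u ω` lies in a closed ball iff, for every `k`, a point of a countable
dense subset of the ball satisfies the first `k` inequalities `⟨D ω zᵢ - y ω, zᵢ - x⟩ ≥ 0` up to an
error `1 / k`; this is a countable combination of measurable conditions. -/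
theorem IsMonotoneHemicontinuous.measurable_solution {Ω : Type*} {m : MeasurableSpace Ω}
    [TopologicalSpace.SeparableSpace V] [MeasurableSpace V] [BorelSpace V]
    (hrefl : Function.Surjective (NormedSpace.inclusionInDoubleDual ℝ V))
    {D : Ω → V → StrongDual ℝ V} {y : Ω → StrongDual ℝ V} {u : Ω → V} {S : Set Ω}
    (hS : MeasurableSet S) (hD : ∀ ω ∈ S, IsMonotoneHemicontinuous (D ω))
    (hinj : ∀ ω ∈ S, Function.Injective (D ω)) (hu : ∀ ω ∈ S, D ω (u ω) = y ω)
    (hu0 : ∀ ω ∉ S, u ω = 0) (hDm : ∀ z v, Measurable fun ω => D ω z v)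
    (hym : ∀ v, Measurable fun ω => y ω v) : Measurable u := by
  refine measurable_of_measurableSet_preimage_closedBall fun c R => ?_
  have hsplit : u ⁻¹' Metric.closedBall c R = (S ∩ u ⁻¹' Metric.closedBall c R) ∪
      (Sᶜ ∩ {_ω | (0 : V) ∈ Metric.closedBall c R}) := by
    ext ω
    by_cases hω : ω ∈ S
    · simp [hω]
    · simp [hω, hu0 ω hω]
  rw [hsplit]
  refine MeasurableSet.union ?_ (hS.compl.inter (MeasurableSet.const _))
  let z := TopologicalSpace.denseSeq V
  obtain ⟨Q, hQb, hQc, hQd⟩ := TopologicalSpace.IsSeparable.exists_countable_dense_subset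
    (TopologicalSpace.IsSeparable.of_separableSpace (Metric.closedBall c R))
  have hQ : S ∩ u ⁻¹' Metric.closedBall c R = S ∩ ⋂ k : ℕ, ⋃ x ∈ Q, ⋂ i ∈ Finset.range (k + 1),
      {ω | -(1 / ((k : ℝ) + 1)) < (D ω (z i) - y ω) (z i - x)} := by
    ext ω
    simp only [Set.mem_inter_iff, Set.mem_preimage, Set.mem_iInter, Set.mem_iUnion,
      Set.mem_ofPred_eq, exists_prop, and_congr_right_iff]
    intro hω
    constructor
    · intro hmem k
      have hopen : IsOpen {x : V | ∀ i ∈ Finset.range (k + 1),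
          -(1 / ((k : ℝ) + 1)) < (D ω (z i) - y ω) (z i - x)} := by
        simp only [Set.ofPred_forall]
        exact isOpen_biInter_finset fun i _ => isOpen_lt continuous_const (by fun_prop)
      have hin : u ω ∈ {x : V | ∀ i ∈ Finset.range (k + 1),
          -(1 / ((k : ℝ) + 1)) < (D ω (z i) - y ω) (z i - x)} := fun i _ => by
        have h1 := (hD ω hω).mono (z i) (u ω)
        rw [hu ω hω] at h1
        have h2 : 0 < 1 / ((k : ℝ) + 1) := by positivity
        linarith
      obtain ⟨x, hxO, hxQ⟩ := mem_closure_iff.1 (hQd hmem) _ hopen hin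
      exact ⟨x, hxQ, hxO⟩
    · intro h
      obtain ⟨x, hx, hx'⟩ := exists_mem_closedBall_forall_le_of_finset hrefl
        (ι := {q : ℕ × ℕ // q.2 ≤ q.1}) c R (fun q => -(D ω (z q.1.2) - y ω))
        (fun q => -(1 / ((q.1.1 : ℝ) + 1)) - (D ω (z q.1.2) - y ω) (z q.1.2)) (fun s => by
          let K := s.sup fun q => q.1.1
          obtain ⟨x, hxQ, hxK⟩ := h K
          refine ⟨x, hQb hxQ, fun q hq => ?_⟩
          have hqK : q.1.1 ≤ K := Finset.le_sup (f := fun q : {q : ℕ × ℕ // q.2 ≤ q.1} => q.1.1) hq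
          have h1 := hxK q.1.2 (Finset.mem_range.2 (by have := q.2; omega))
          have h2 : 1 / ((K : ℝ) + 1) ≤ 1 / ((q.1.1 : ℝ) + 1) := by
            have : (q.1.1 : ℝ) ≤ K := by exact_mod_cast hqK
            gcongr
          rw [map_sub] at h1
          simp only [neg_apply]
          linarith)
      have hx0 : D ω x = y ω := by
        refine (hD ω hω).apply_eq_of_forall_denseRange
          (TopologicalSpace.denseRange_denseSeq V) fun i => ?_
        have hlim : Tendsto (fun k : ℕ => -(1 / ((k : ℝ) + 1))) atTop (𝓝 (-0)) :=
          tendsto_one_div_add_atTop_nhds_zero_nat.neg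
        rw [neg_zero] at hlim
        refine le_of_tendsto hlim ?_
        filter_upwards [eventually_ge_atTop i] with k hk
        have h1 := hx' ⟨(k, i), hk⟩
        simp only [neg_apply] at h1
        rw [map_sub]
        linarith
      rwa [hinj ω hω ((hu ω hω).trans hx0.symm)]
  rw [hQ]
  refine hS.inter (MeasurableSet.iInter fun k => MeasurableSet.biUnion hQc fun x _ =>
    Finset.measurableSet_biInter _ fun i _ => measurableSet_lt measurable_const ?_)
  have h1 : (fun ω => (D ω (z i) - y ω) (z i - x))
      = fun ω => D ω (z i) (z i - x) - y ω (z i - x) := rfl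
  rw [h1]
  exact (hDm _ _).sub (hym _)

end MeasurableSolution

/-! ### The implicit step for a frozen path -/

section ImplicitStep

variable {S V H : Type*} [MeasurableSpace S] [NormedAddCommGroup V] [NormedSpace ℝ V]
  [NormedAddCommGroup H] [InnerProductSpace ℝ H]

theorem pivot_apply (j : V →L[ℝ] H) (h : H) (v : V) : pivot j h v = inner ℝ h (j v) := rfl

/-- The properties of a coefficient `a : S × V → V*` on a measure space `(S, μ)` (a time interval)
that make `x ↦ x - ∫ a(s, x) μ(ds)` a monotone, hemicontinuous and coercive operator. -/
structure IsDissipativeFamily (μ : Measure S) (j : V →L[ℝ] H) (p : ℝ) (k lam K K' : S → ℝ)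
    (a : S → V → StrongDual ℝ V) : Prop where
  meas : ∀ x, AEStronglyMeasurable (fun s => a s x) μ
  mono : ∀ᵐ s ∂μ, ∀ x y, (a s x - a s y) (x - y) ≤ 0
  hemi : ∀ᵐ s ∂μ, ∀ x w, Tendsto (fun ε : ℝ => a s (x + ε • w) w) (𝓝[>] 0) (𝓝 (a s x w))
  growth : ∀ᵐ s ∂μ, ∀ x, ‖a s x‖ ≤ k s * (1 + ‖x‖ ^ p)
  coer : ∀ᵐ s ∂μ, ∀ x, 2 * a s x x + lam s * ‖x‖ ^ p ≤ K s + K' s * ‖j x‖ ^ 2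
  integrable_k : Integrable k μ
  integrable_lam : Integrable lam μ
  integrable_K : Integrable K μ
  integrable_K' : Integrable K' μ
  integral_K'_le : ∫ s, K' s ∂μ ≤ 1

/-- The operator `x ↦ x - ∫ a(s, x) μ(ds)` of an implicit Euler step. -/
noncomputable def implicitOp (μ : Measure S) (j : V →L[ℝ] H) (a : S → V → StrongDual ℝ V) (x : V) :
    StrongDual ℝ V :=
  pivot j (j x) - ∫ s, a s x ∂μ

namespace IsDissipativeFamily

variable {μ : Measure S} {j : V →L[ℝ] H} {p : ℝ} {k lam K K' : S → ℝ}
  {a : S → V → StrongDual ℝ V}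

theorem integrable (ha : IsDissipativeFamily μ j p k lam K K' a) (x : V) :
    Integrable (fun s => a s x) μ :=
  (ha.integrable_k.mul_const _).mono' (ha.meas x) (by filter_upwards [ha.growth] with s h using h x)

theorem implicitOp_apply (ha : IsDissipativeFamily μ j p k lam K K' a) (x v : V) :
    implicitOp μ j a x v = inner ℝ (j x) (j v) - ∫ s, a s x v ∂μ := by
  rw [implicitOp, sub_apply, pivot_apply, ContinuousLinearMap.integral_apply (ha.integrable x)]

theorem inner_le_implicitOp_sub (ha : IsDissipativeFamily μ j p k lam K K' a) (x y : V) :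
    ‖j (x - y)‖ ^ 2 ≤ (implicitOp μ j a x - implicitOp μ j a y) (x - y) := by
  rw [sub_apply, ha.implicitOp_apply, ha.implicitOp_apply]
  have h1 : ∫ s, a s x (x - y) ∂μ - ∫ s, a s y (x - y) ∂μ ≤ 0 := by
    rw [← integral_sub ((ha.integrable x).apply_continuousLinearMap _)
      ((ha.integrable y).apply_continuousLinearMap _)]
    refine integral_nonpos_of_ae ?_
    filter_upwards [ha.mono] with s hs using hs x y
  have h2 : ‖j (x - y)‖ ^ 2 = inner ℝ (j x) (j (x - y)) - inner ℝ (j y) (j (x - y)) := by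
    rw [← inner_sub_left, ← map_sub, real_inner_self_eq_norm_sq]
  linarith

theorem implicitOp_injective (ha : IsDissipativeFamily μ j p k lam K K' a)
    (hj : Function.Injective j) : Function.Injective (implicitOp μ j a) := by
  intro x y hxy
  have h := ha.inner_le_implicitOp_sub x y
  rw [hxy, sub_self, zero_apply] at h
  have h0 : j (x - y) = 0 := by
    have : ‖j (x - y)‖ ^ 2 = 0 := le_antisymm h (by positivity)
    simpa using this
  rw [← sub_eq_zero]
  exact hj (by rw [h0, map_zero])

theorem isMonotoneHemicontinuous (ha : IsDissipativeFamily μ j p k lam K K' a) (hp : 0 ≤ p) :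
    IsMonotoneHemicontinuous (implicitOp μ j a) where
  mono x y := (by positivity : (0 : ℝ) ≤ ‖j (x - y)‖ ^ 2).trans (ha.inner_le_implicitOp_sub x y)
  hemi x w := by
    simp_rw [ha.implicitOp_apply]
    refine Tendsto.sub ?_ ?_
    · have hc : Continuous fun ε : ℝ => inner ℝ (j (x + ε • w)) (j w) := by fun_prop
      have := hc.tendsto 0
      rw [zero_smul, add_zero] at this
      exact tendsto_nhdsWithin_of_tendsto_nhds this
    · refine tendsto_integral_filter_of_dominated_convergence
        (fun s => k s * (1 + (‖x‖ + ‖w‖) ^ p) * ‖w‖)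
        (Eventually.of_forall fun ε => ((ha.integrable _).apply_continuousLinearMap w).1) ?_
        ((ha.integrable_k.mul_const _).mul_const _) ?_
      · filter_upwards [Ioc_mem_nhdsGT (zero_lt_one' ℝ)] with ε hε
        filter_upwards [ha.growth] with s hs
        refine ((a s _).le_opNorm w).trans (mul_le_mul_of_nonneg_right ?_ (norm_nonneg _))
        have hk : 0 ≤ k s := by
          have := (norm_nonneg _).trans (hs 0)
          exact nonneg_of_mul_nonneg_left this (by positivity)
        refine (hs _).trans ?_
        have hn : ‖x + ε • w‖ ≤ ‖x‖ + ‖w‖ := by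
          refine (norm_add_le _ _).trans ?_
          rw [norm_smul, Real.norm_of_nonneg hε.1.le]
          have := mul_le_mul_of_nonneg_right hε.2 (norm_nonneg w)
          linarith
        gcongr
      · filter_upwards [ha.hemi] with s hs using hs x w
  bdd R := by
    refine ⟨‖j‖ * R * ‖j‖ + (∫ s, k s ∂μ) * (1 + R ^ p), fun x hx => ?_⟩
    have hk : 0 ≤ ∫ s, k s ∂μ := by
      refine integral_nonneg_of_ae ?_
      filter_upwards [ha.growth] with s hs
      exact nonneg_of_mul_nonneg_left ((norm_nonneg _).trans (hs 0)) (by positivity)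
    have hR : 0 ≤ R := (norm_nonneg _).trans hx
    refine (norm_sub_le _ _).trans (add_le_add ?_ ?_)
    · refine ContinuousLinearMap.opNorm_le_bound _ (by positivity) fun v => ?_
      rw [pivot_apply]
      refine (norm_inner_le_norm _ _).trans ?_
      have h1 : ‖j x‖ ≤ ‖j‖ * R := (j.le_opNorm x).trans (by gcongr)
      have h2 := j.le_opNorm v
      calc ‖j x‖ * ‖j v‖ ≤ ‖j‖ * R * (‖j‖ * ‖v‖) := by gcongr
        _ = _ := by ring
    · rw [← integral_mul_const]
      refine norm_integral_le_of_norm_le (ha.integrable_k.mul_const _) ?_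
      filter_upwards [ha.growth] with s hs
      have hks := nonneg_of_mul_nonneg_left ((norm_nonneg _).trans (hs 0)) (by positivity)
      exact (hs x).trans (by gcongr)

/-- The coercivity estimate of the implicit step. -/
theorem le_implicitOp_sub_pivot (ha : IsDissipativeFamily μ j p k lam K K' a) (h : H) (x : V) :
    ((∫ s, lam s ∂μ) * ‖x‖ ^ p - (∫ s, K s ∂μ) - ‖h‖ ^ 2) / 2
      ≤ (implicitOp μ j a x - pivot j h) x := by
  rw [sub_apply, ha.implicitOp_apply, pivot_apply, real_inner_self_eq_norm_sq]
  have hI := (ha.integrable x).apply_continuousLinearMap x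
  have h1 : 2 * ∫ s, a s x x ∂μ + (∫ s, lam s ∂μ) * ‖x‖ ^ p
      ≤ (∫ s, K s ∂μ) + (∫ s, K' s ∂μ) * ‖j x‖ ^ 2 := by
    rw [← integral_const_mul, ← integral_mul_const, ← integral_mul_const,
      ← integral_add (hI.const_mul 2) (ha.integrable_lam.mul_const _),
      ← integral_add ha.integrable_K (ha.integrable_K'.mul_const _)]
    refine integral_mono_ae ((hI.const_mul 2).add (ha.integrable_lam.mul_const _))
      (ha.integrable_K.add (ha.integrable_K'.mul_const _)) ?_
    filter_upwards [ha.coer] with s hs using hs x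
  have h2 : (∫ s, K' s ∂μ) * ‖j x‖ ^ 2 ≤ ‖j x‖ ^ 2 :=
    mul_le_of_le_one_left (by positivity) ha.integral_K'_le
  have h3 := real_inner_le_norm h (j x)
  nlinarith [sq_nonneg (‖h‖ - ‖j x‖)]

theorem exists_implicitOp_eq (ha : IsDissipativeFamily μ j p k lam K K' a)
    (hrefl : Function.Surjective (NormedSpace.inclusionInDoubleDual ℝ V)) (hp : 1 ≤ p)
    (hlam : 0 < ∫ s, lam s ∂μ) (h : H) : ∃ x, implicitOp μ j a x = pivot j h := by
  set Λ := ∫ s, lam s ∂μ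
  set κ := ∫ s, K s ∂μ
  set R := 1 + (|κ| + ‖h‖ ^ 2) / Λ
  have hR : 1 ≤ R := le_add_of_nonneg_right (by positivity)
  refine (ha.isMonotoneHemicontinuous (by linarith)).exists_apply_eq hrefl _ (R := R)
    (by linarith) fun x hx => lt_of_lt_of_le ?_ (ha.le_implicitOp_sub_pivot h x)
  rw [hx]
  have h1 : R ≤ R ^ p := Real.self_le_rpow_of_one_le hR hp
  have h2 : Λ * R = Λ + (|κ| + ‖h‖ ^ 2) := by
    simp only [R]; field_simp
  have h3 : Λ * R ≤ Λ * R ^ p := by gcongr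
  have h4 := le_abs_self κ
  linarith

theorem mul_norm_rpow_le (ha : IsDissipativeFamily μ j p k lam K K' a) {h : H} {x : V}
    (hx : implicitOp μ j a x = pivot j h) :
    (∫ s, lam s ∂μ) * ‖x‖ ^ p ≤ (∫ s, K s ∂μ) + ‖h‖ ^ 2 := by
  have := ha.le_implicitOp_sub_pivot h x
  rw [hx, sub_self, zero_apply] at this
  linarith

end IsDissipativeFamily

end ImplicitStep

/-! ### Measurability of time averages -/

section TimeMeasure

instance sigmaFinite_timeMeasure : SigmaFinite timeMeasure := by
  refine ⟨⟨⟨fun n => Set.Iic (n : ℝ≥0), fun _ => trivial, fun n => ?_, ?_⟩⟩⟩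
  · refine lt_of_le_of_lt (measure_mono (t := Set.Iic (n : ℝ≥0)) le_rfl) ?_
    have he : MeasurableEmbedding (fun t : ℝ≥0 => (t : ℝ)) :=
      MeasurableEmbedding.subtype_coe measurableSet_Ici
    rw [timeMeasure, he.comap_apply]
    refine lt_of_le_of_lt (measure_mono (t := Set.Icc (0 : ℝ) n) ?_) measure_Icc_lt_top
    rintro _ ⟨t, ht, rfl⟩
    exact ⟨t.2, by exact_mod_cast ht⟩
  · refine Set.eq_univ_of_forall fun t => Set.mem_iUnion.2 ?_
    obtain ⟨n, hn⟩ := exists_nat_ge t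
    exact ⟨n, hn⟩

end TimeMeasure

section ParameterIntegrals

variable {Ω V E Y : Type*} {mΩ : MeasurableSpace Ω} {𝓕 : Filtration ℝ≥0 mΩ} {T : ℝ≥0}
  [MeasurableSpace V] [MeasurableSpace E] [MeasurableSpace Y]

/-- A progressively measurable coefficient, frozen at time `b` (i.e. with time replaced by
`min s b`), is measurable with respect to the Borel sets in time and space and `𝓕 b`. -/
theorem ProgressivelyMeasurableCoeff.measurable_min {G : ℝ≥0 → Ω → V → Y}
    (hG : ProgressivelyMeasurableCoeff 𝓕 T G) {b : ℝ≥0} (hb : b ≤ T) :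
    Measurable[((𝓕 b).prod inferInstance).prod inferInstance]
      (fun z : (Ω × V) × ℝ≥0 => G (min z.2 b) z.1.1 z.1.2) := by
  let f : Set.Iic b × Ω → Set.Iic T × Ω := fun z => (⟨z.1, (Set.mem_Iic.1 z.1.2).trans hb⟩, z.2)
  have hf : Measurable[Subtype.instMeasurableSpace.prod (𝓕 b), progressiveSigma 𝓕 T] f := by
    have h := iInf_le (fun t : Set.Iic T => MeasurableSpace.map
      (fun z : Set.Iic (t : ℝ≥0) × Ω =>
        ((⟨z.1, Set.mem_Iic.2 (le_trans (Set.mem_Iic.1 z.1.2) (Set.mem_Iic.1 t.2))⟩ : Set.Iic T),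
          z.2)) (Subtype.instMeasurableSpace.prod (𝓕 (t : ℝ≥0)))) ⟨b, hb⟩
    intro S hS
    exact h S hS
  let : MeasurableSpace Ω := 𝓕 b
  let : MeasurableSpace (Set.Iic T × Ω) := progressiveSigma 𝓕 T
  have hm : Measurable fun z : (Ω × V) × ℝ≥0 =>
      ((f (⟨min z.2 b, Set.mem_Iic.2 (min_le_right _ _)⟩, z.1.1), z.1.2) :
        (Set.Iic T × Ω) × V) := by
    refine Measurable.prodMk (hf.comp (Measurable.prodMk ?_ (by fun_prop))) (by fun_prop)
    exact Measurable.subtype_mk (by fun_prop)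
  exact Measurable.comp hG hm

/-- The analogue of `ProgressivelyMeasurableCoeff.measurable_min` for a predictable coefficient. -/
theorem PredictableCoeff.measurable_min {G : ℝ≥0 → Ω → V → E → Y}
    (hG : PredictableCoeff 𝓕 T G) {b : ℝ≥0} (hb : b ≤ T) :
    Measurable[(((𝓕 b).prod inferInstance).prod inferInstance).prod inferInstance]
      (fun z : ((Ω × V) × ℝ≥0) × E => G (min z.1.2 b) z.1.1.1 z.1.1.2 z.2) := by
  let f : Set.Iic b × Ω → Set.Iic T × Ω := fun z => (⟨z.1, (Set.mem_Iic.1 z.1.2).trans hb⟩, z.2)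
  have hf : Measurable[Subtype.instMeasurableSpace.prod (𝓕 b), predictableSigma 𝓕 T] f :=
    measurable_comap_iff.2 measurable_inclusion_predictable
  let : MeasurableSpace Ω := 𝓕 b
  let : MeasurableSpace (Set.Iic T × Ω) := predictableSigma 𝓕 T
  have hm : Measurable fun z : ((Ω × V) × ℝ≥0) × E =>
      (((f (⟨min z.1.2 b, Set.mem_Iic.2 (min_le_right _ _)⟩, z.1.1.1), z.1.1.2), z.2) :
        ((Set.Iic T × Ω) × V) × E) := by
    refine Measurable.prodMk (Measurable.prodMk (hf.comp (Measurable.prodMk ?_ (by fun_prop)))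
      (by fun_prop)) (by fun_prop)
    exact Measurable.subtype_mk (by fun_prop)
  exact Measurable.comp hG hm

variable [NormedAddCommGroup Y] [BorelSpace Y] [SecondCountableTopology Y]

theorem ProgressivelyMeasurableCoeff.aestronglyMeasurable {G : ℝ≥0 → Ω → V → Y}
    (hG : ProgressivelyMeasurableCoeff 𝓕 T G) {a b : ℝ≥0} (hb : b ≤ T) (ω : Ω) (x : V) :
    AEStronglyMeasurable (fun s => G s ω x) (timeMeasure.restrict (Set.Ioc a b)) := by
  have hm := hG.measurable_min hb
  let : MeasurableSpace Ω := 𝓕 b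
  have h1 : Measurable fun s : ℝ≥0 => G (min s b) ω x :=
    hm.comp (f := fun s : ℝ≥0 => (((ω, x), s) : (Ω × V) × ℝ≥0)) (by fun_prop)
  refine h1.aestronglyMeasurable.congr ?_
  filter_upwards [ae_restrict_mem measurableSet_Ioc] with s hs
  simp only [min_eq_left hs.2]

variable [NormedSpace ℝ Y]

theorem ProgressivelyMeasurableCoeff.measurable_integral {G : ℝ≥0 → Ω → V → Y}
    (hG : ProgressivelyMeasurableCoeff 𝓕 T G) {a b : ℝ≥0} (hb : b ≤ T) :
    Measurable[(𝓕 b).prod inferInstance]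
      (fun z : Ω × V => ∫ s in Set.Ioc a b, G s z.1 z.2 ∂timeMeasure) := by
  have hm := hG.measurable_min hb
  let : MeasurableSpace Ω := 𝓕 b
  have h1 := (hm.stronglyMeasurable.integral_prod_right'
    (ν := timeMeasure.restrict (Set.Ioc a b))).measurable
  refine (congrArg (fun f => Measurable f) (funext fun z => ?_)).mp h1
  refine setIntegral_congr_fun measurableSet_Ioc fun s hs => ?_
  simp only [min_eq_left hs.2]

theorem PredictableCoeff.measurable_integral {G : ℝ≥0 → Ω → V → E → Y}
    (hG : PredictableCoeff 𝓕 T G) {a b : ℝ≥0} (hb : b ≤ T) (ν : Measure E) [SFinite ν] (C : Set E) :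
    Measurable[(𝓕 b).prod inferInstance]
      (fun z : Ω × V => ∫ s in Set.Ioc a b, (∫ η in C, G s z.1 z.2 η ∂ν) ∂timeMeasure) := by
  have hm := hG.measurable_min hb
  let : MeasurableSpace Ω := 𝓕 b
  have h1 := ((hm.stronglyMeasurable.integral_prod_right' (ν := ν.restrict C)).integral_prod_right'
    (ν := timeMeasure.restrict (Set.Ioc a b))).measurable
  refine (congrArg (fun f => Measurable f) (funext fun z => ?_)).mp h1
  refine setIntegral_congr_fun measurableSet_Ioc fun s hs => ?_
  simp only [min_eq_left hs.2]

end ParameterIntegrals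

section SeparableHilbertSchmidt

variable {ι U H : Type*} [NormedAddCommGroup U] [InnerProductSpace ℝ U]
  [NormedAddCommGroup H] [InnerProductSpace ℝ H]

instance HilbertSchmidt.separableSpace [Countable ι] [TopologicalSpace.SeparableSpace H]
    (g : HilbertBasis ι ℝ U) : TopologicalSpace.SeparableSpace (HilbertSchmidt g H) := by
  classical
  have hiso : Isometry (HilbertSchmidt.toSeq g H) :=
    AddMonoidHomClass.isometry_of_norm _ fun _ => rfl
  have hsep : TopologicalSpace.IsSeparable (Set.univ : Set (lp (fun _ : ι => H) 2)) := by
    have h1 : TopologicalSpace.IsSeparable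
        (⋃ k : ι, Set.range fun x : H => lp.single (E := fun _ : ι => H) 2 k x) :=
      TopologicalSpace.IsSeparable.iUnion fun k => TopologicalSpace.isSeparable_range (by
        refine (AddMonoidHomClass.isometry_of_norm
          (lp.singleAddMonoidHom (E := fun _ : ι => H) 2 k) fun x => ?_).continuous
        exact lp.norm_single (p := 2) (E := fun _ : ι => H) (by norm_num) k x)
    refine (h1.span (R := ℝ)).closure.mono fun f _ => ?_
    have h2 := lp.hasSum_single (p := 2) (E := fun _ : ι => H) (by norm_num) f
    refine mem_closure_of_tendsto h2 (Eventually.of_forall fun s => ?_)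
    exact Submodule.sum_mem _ fun k _ =>
      Submodule.subset_span (Set.mem_iUnion.2 ⟨k, _, rfl⟩)
  have h3 : SecondCountableTopology (lp (fun _ : ι => H) 2) := by
    have := TopologicalSpace.isSeparable_univ_iff.1 hsep
    exact UniformSpace.secondCountable_of_separable _
  have := hiso.isEmbedding.secondCountableTopology
  infer_instance

/-- Evaluation of Hilbert-Schmidt operators at a basis vector. -/
noncomputable def HilbertSchmidt.evalBasis (g : HilbertBasis ι ℝ U) (k : ι) :
    HilbertSchmidt g H →L[ℝ] H :=
  LinearMap.mkContinuous
    { toFun := fun S => S.toCLM (g k)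
      map_add' := fun _ _ => rfl
      map_smul' := fun _ _ => rfl } 1 fun S => by
    rw [one_mul]
    exact lp.norm_apply_le_norm (by norm_num) (HilbertSchmidt.toSeq g H S) k

theorem HilbertSchmidt.norm_toCLM_basis_le (g : HilbertBasis ι ℝ U) (k : ι)
    (S : HilbertSchmidt g H) : ‖S.toCLM (g k)‖ ≤ ‖S‖ :=
  lp.norm_apply_le_norm (by norm_num) (HilbertSchmidt.toSeq g H S) k

end SeparableHilbertSchmidt

/-! ### Moments of the noise -/

section Moments

variable {Ω : Type*} {mΩ : MeasurableSpace Ω} {P : Measure Ω}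

/-- The product of independent square integrable factors is square integrable. -/
theorem memLp_two_smul_of_indep {H : Type*} [NormedAddCommGroup H] [NormedSpace ℝ H]
    [MeasurableSpace H] [BorelSpace H] [SecondCountableTopology H] {m₁ m₂ : MeasurableSpace Ω}
    (h₁ : m₁ ≤ mΩ) (h₂ : m₂ ≤ mΩ) (hind : Indep m₁ m₂ P) {X : Ω → ℝ} {f : Ω → H}
    (hX : Measurable[m₁] X) (hf : Measurable[m₂] f) (hX2 : MemLp X 2 P) (hf2 : MemLp f 2 P) :
    MemLp (fun ω => X ω • f ω) 2 P := by
  have hX' : Measurable[mΩ] X := hX.mono h₁ le_rfl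
  have hf' : Measurable[mΩ] f := hf.mono h₂ le_rfl
  refine ⟨(hX'.smul hf').aestronglyMeasurable, ?_⟩
  have hX3 := hX2.2
  have hf3 := hf2.2
  rw [eLpNorm_lt_top_iff_lintegral_rpow_enorm_lt_top (by norm_num) (by norm_num)] at hX3 hf3 ⊢
  have h := lintegral_mul_eq_lintegral_mul_lintegral_of_independent_measurableSpace h₁ h₂ hind
    (f := fun ω => ‖X ω‖ₑ ^ (2 : ℝ≥0∞).toReal) (g := fun ω => ‖f ω‖ₑ ^ (2 : ℝ≥0∞).toReal)
    ((measurable_enorm.pow_const _).comp hX) ((measurable_enorm.pow_const _).comp hf)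
  have h' : ∫⁻ ω, ‖X ω • f ω‖ₑ ^ (2 : ℝ≥0∞).toReal ∂P
      = ∫⁻ ω, ‖X ω‖ₑ ^ (2 : ℝ≥0∞).toReal * ‖f ω‖ₑ ^ (2 : ℝ≥0∞).toReal ∂P :=
    lintegral_congr fun ω => by
      rw [enorm_smul, ENNReal.mul_rpow_of_nonneg _ _ (by norm_num)]
  rw [h', h]
  exact ENNReal.mul_lt_top hX3 hf3

theorem memLp_two_of_hasLaw_poisson {r : ℝ≥0} {X : Ω → ℝ≥0∞}
    (hX : HasLaw X ((poissonMeasure r).map (fun n : ℕ => (n : ℝ≥0∞))) P) :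
    MemLp (fun ω => (X ω).toReal) 2 P := by
  have hm : Measurable (fun n : ℕ => (n : ℝ≥0∞)) := measurable_from_nat
  have hr : Measurable ENNReal.toReal := ENNReal.measurable_toReal
  have h1 : MemLp (fun n : ℕ => (n : ℝ)) 2 (poissonMeasure r) := by
    rw [memLp_two_iff_integrable_sq_norm measurable_from_nat.aestronglyMeasurable,
      integrable_poissonMeasure_iff]
    -- the series `∑ n² rⁿ / n!` is dominated by `∑ (4 r)ⁿ / n!`
    refine Summable.of_nonneg_of_le (fun n => by positivity) (fun n => ?_)
      ((Real.summable_pow_div_factorial (4 * r)).mul_left (Real.exp (-r)))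
    have h2 : (n : ℝ) ≤ 2 ^ n := by exact_mod_cast (Nat.lt_two_pow_self (n := n)).le
    have h3 : (n : ℝ) ^ 2 ≤ 4 ^ n := by
      calc (n : ℝ) ^ 2 ≤ (2 ^ n) ^ 2 := by gcongr
        _ = 4 ^ n := by rw [← pow_mul, mul_comm, pow_mul]; norm_num
    have h4 : ‖‖(n : ℝ)‖ ^ 2‖ = (n : ℝ) ^ 2 := by simp
    rw [h4, mul_pow]
    calc Real.exp (-r) * (r : ℝ) ^ n / (n.factorial : ℝ) * (n : ℝ) ^ 2
        ≤ Real.exp (-r) * (r : ℝ) ^ n / (n.factorial : ℝ) * 4 ^ n := by gcongr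
      _ = _ := by ring
  have h2 : MemLp ENNReal.toReal 2 ((poissonMeasure r).map (fun n : ℕ => (n : ℝ≥0∞))) := by
    rw [memLp_map_measure_iff hr.aestronglyMeasurable hm.aemeasurable]
    simpa [Function.comp_def] using h1
  rw [← hX.map_eq, memLp_map_measure_iff hr.aestronglyMeasurable hX.aemeasurable] at h2
  exact h2

theorem ae_lt_top_of_hasLaw_poisson {r : ℝ≥0} {X : Ω → ℝ≥0∞}
    (hX : HasLaw X ((poissonMeasure r).map (fun n : ℕ => (n : ℝ≥0∞))) P) : ∀ᵐ ω ∂P, X ω < ∞ := by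
  have hm : Measurable (fun n : ℕ => (n : ℝ≥0∞)) := measurable_from_nat
  have h1 : ∀ᵐ x ∂((poissonMeasure r).map (fun n : ℕ => (n : ℝ≥0∞))), x < ∞ := by
    rw [ae_map_iff hm.aemeasurable measurableSet_Iio]
    exact Eventually.of_forall fun n => ENNReal.natCast_lt_top n
  rw [← hX.map_eq, ae_map_iff hX.aemeasurable measurableSet_Iio] at h1
  exact h1

theorem memLp_two_of_hasLaw_gaussian {v : ℝ≥0} {X : Ω → ℝ} (hX : HasLaw X (gaussianReal 0 v) P) :
    MemLp X 2 P := by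
  have h1 : MemLp id 2 (gaussianReal 0 v) := memLp_id_gaussianReal 2
  rw [← hX.map_eq, memLp_map_measure_iff aestronglyMeasurable_id hX.aemeasurable] at h1
  exact h1

end Moments

/-! ### Pathwise consequences of the conditions on the coefficients -/

section RegularPath

variable {V H Y E Ω : Type*} [NormedAddCommGroup V] [NormedSpace ℝ V]
  [NormedAddCommGroup H] [InnerProductSpace ℝ H] [NormedAddCommGroup Y] [MeasurableSpace E]
  {mΩ : MeasurableSpace Ω}

/-- The growth condition, brought into the form that is used, by Young's inequality for
`(a / lam) * y`. -/
theorem mul_le_of_growth {p q : ℝ} (hpq : p.HolderConjugate q) {a lam α K x y : ℝ} (ha : 0 ≤ a)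
    (hlam : 0 < lam) (hy : 0 ≤ y) (h : a ^ q ≤ α * lam ^ q * x ^ p + K * lam ^ (q - 1)) :
    a * y ≤ lam * (α * x ^ p + y ^ p) + K := by
  have h1 : (a / lam) ^ q ≤ α * x ^ p + K / lam := by
    rw [Real.div_rpow ha hlam.le, div_le_iff₀ (Real.rpow_pos_of_pos hlam q)]
    refine h.trans (le_of_eq ?_)
    rw [Real.rpow_sub_one hlam.ne']
    field_simp
  have h2 := Real.young_inequality_of_nonneg hy (div_nonneg ha hlam.le) hpq
  have h3 : y ^ p / p ≤ y ^ p := div_le_self (by positivity) hpq.lt.le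
  have h4 : (a / lam) ^ q / q ≤ (a / lam) ^ q :=
    div_le_self (by positivity) hpq.symm.lt.le
  have h5 : y * (a / lam) ≤ α * x ^ p + y ^ p + K / lam := by linarith
  calc a * y = lam * (y * (a / lam)) := by field_simp
    _ ≤ lam * (α * x ^ p + y ^ p + K / lam) := by gcongr
    _ = _ := by field_simp

theorem sq_le_one_add_rpow {p x : ℝ} (hp : 2 ≤ p) (hx : 0 ≤ x) : x ^ 2 ≤ 1 + x ^ p := by
  rcases le_total x 1 with h | h
  · have : 0 ≤ x ^ p := by positivity
    nlinarith
  · have := Real.rpow_le_rpow_of_exponent_le h hp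
    rw [Real.rpow_two] at this
    linarith

/-- What the conditions on the coefficients say about a single path, with all growth bounds
expressed by one function `k` of time. -/
structure IsRegularPath (T : ℝ≥0) (ν : Measure E) (j : V →L[ℝ] H) (p : ℝ) (k lam K₁ K₁' : ℝ≥0 → ℝ)
    (a : ℝ≥0 → V → StrongDual ℝ V) (b : ℝ≥0 → V → Y) (f : ℝ≥0 → V → E → H) : Prop where
  mono : ∀ t ≤ T, ∀ x y, (a t x - a t y) (x - y) ≤ 0
  hemi : ∀ t ≤ T, ∀ x w, Tendsto (fun ε : ℝ => a t (x + ε • w) w) (𝓝[>] 0) (𝓝 (a t x w))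
  growth : ∀ t ≤ T, ∀ x, ‖a t x‖ ≤ k t * (1 + ‖x‖ ^ p)
  coer : ∀ t ≤ T, ∀ x, 2 * a t x x + lam t * ‖x‖ ^ p ≤ K₁ t + K₁' t * ‖j x‖ ^ 2
  diffusion : ∀ t ≤ T, ∀ x, ‖b t x‖ ^ 2 ≤ k t * (1 + ‖x‖ ^ p)
  integrable_jump : ∀ t ≤ T, ∀ x, Integrable (fun ξ => ‖f t x ξ‖ ^ 2) ν
  jump : ∀ t ≤ T, ∀ x, ∫ ξ, ‖f t x ξ‖ ^ 2 ∂ν ≤ k t * (1 + ‖x‖ ^ p)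

theorem exists_forall_isRegularPath {P : Measure Ω} {T : ℝ≥0} {ν : Measure E} {j : V →L[ℝ] H}
    {A : ℝ≥0 → Ω → V → StrongDual ℝ V} {B : ℝ≥0 → Ω → V → Y} {F : ℝ≥0 → Ω → V → E → H}
    {p q : ℝ} (hp : 2 ≤ p) (hpq : 1 / p + 1 / q = 1) {lam K₁ K₁' K₂ : ℝ≥0 → ℝ}
    (hlam : PosIntegrable T lam) (hK₁ : NonnegIntegrable T K₁) (hK₁' : NonnegIntegrable T K₁')
    (hK₂ : NonnegIntegrable T K₂) (hmono : MonotonicityCondition P T ν A B F)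
    (hcoer : CoercivityCondition j P T ν p lam K₁ K₁' A B F)
    (hgrowth : GrowthCondition P T p q lam K₂ A) (hhemi : HemicontinuityCondition P T A) :
    ∃ k : ℝ≥0 → ℝ, IntegrableOn k (Set.Iic T) timeMeasure ∧
      ∀ᵐ ω ∂P, IsRegularPath T ν j p k lam K₁ K₁' (fun t => A t ω) (fun t => B t ω)
        (fun t => F t ω) := by
  obtain ⟨α, hα, hgr⟩ := hgrowth
  have hc : p.HolderConjugate q :=
    Real.holderConjugate_iff.2 ⟨by linarith, by simpa only [one_div] using hpq⟩
  refine ⟨fun t => K₁ t + K₁' t * ‖j‖ ^ 2 + 2 * (lam t * (α + 1)) + 2 * K₂ t, ?_, ?_⟩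
  · exact ((hK₁.2.add (hK₁'.2.mul_const _)).add ((hlam.2.mul_const _).const_mul _)).add
      (hK₂.2.const_mul _)
  filter_upwards [hmono, hcoer, hgr, hhemi] with ω h1 h2 h3 h4
  -- the noise coefficients are controlled by coercivity and the growth of `A`
  have key : ∀ t ≤ T, ∀ x, ‖B t ω x‖ ^ 2 + ∫ ξ, ‖F t ω x ξ‖ ^ 2 ∂ν
      ≤ (K₁ t + K₁' t * ‖j‖ ^ 2 + 2 * (lam t * (α + 1)) + 2 * K₂ t) * (1 + ‖x‖ ^ p) := by
    intro t ht x
    have c0 := hlam.1 t ht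
    have c1 := hK₁.1 t ht
    have c2 := hK₁'.1 t ht
    have c3 := hK₂.1 t ht
    have e1 := (h2 x t ht).2
    have e2 := mul_le_of_growth hc (norm_nonneg _) c0 (norm_nonneg x) (h3 x t ht)
    have e3 : -(A t ω x x) ≤ ‖A t ω x‖ * ‖x‖ := (neg_le_abs _).trans ((A t ω x).le_opNorm x)
    have e4 : ‖j x‖ ^ 2 ≤ ‖j‖ ^ 2 * (1 + ‖x‖ ^ p) := by
      calc ‖j x‖ ^ 2 ≤ (‖j‖ * ‖x‖) ^ 2 := by gcongr; exact j.le_opNorm x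
        _ = ‖j‖ ^ 2 * ‖x‖ ^ 2 := by ring
        _ ≤ _ := by gcongr; exact sq_le_one_add_rpow hp (norm_nonneg x)
    have e5 := mul_le_mul_of_nonneg_left e4 c2
    have e6 : 0 ≤ ‖x‖ ^ p := by positivity
    have e7 : 0 ≤ lam t * ‖x‖ ^ p := by positivity
    have e8 : 0 ≤ K₁ t * ‖x‖ ^ p := by positivity
    have e9 : 0 ≤ K₂ t * ‖x‖ ^ p := by positivity
    have e10 : 0 ≤ lam t * (α + 1) := by positivity
    nlinarith
  exact
    { mono := fun t ht x y => by
        have e1 := (h1 x y t ht).2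
        have e2 : 0 ≤ ∫ ξ, ‖F t ω x ξ - F t ω y ξ‖ ^ 2 ∂ν := integral_nonneg fun _ => by positivity
        nlinarith [sq_nonneg ‖B t ω x - B t ω y‖]
      hemi := fun t ht x w => (h4 x w w t ht).mono_left (nhdsWithin_mono _ fun ε hε => ne_of_gt hε)
      growth := fun t ht x => by
        have c0 := hlam.1 t ht
        have c1 := hK₁.1 t ht
        have c2 := hK₁'.1 t ht
        have c3 := hK₂.1 t ht
        have e1 := mul_le_of_growth hc (norm_nonneg _) c0 zero_le_one (h3 x t ht)
        rw [mul_one, Real.one_rpow] at e1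
        refine e1.trans ?_
        have e6 : 0 ≤ ‖x‖ ^ p := by positivity
        have e7 : 0 ≤ (K₁ t + K₁' t * ‖j‖ ^ 2 + lam t * (α + 1)) * (1 + ‖x‖ ^ p) := by positivity
        have e8 : 0 ≤ lam t * ‖x‖ ^ p + lam t * α + K₂ t + 2 * K₂ t * ‖x‖ ^ p := by positivity
        nlinarith
      coer := fun t ht x => by
        have e1 := (h2 x t ht).2
        have e2 : 0 ≤ ∫ ξ, ‖F t ω x ξ‖ ^ 2 ∂ν := integral_nonneg fun _ => by positivity
        nlinarith [sq_nonneg ‖B t ω x‖]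
      diffusion := fun t ht x => by
        have e2 : 0 ≤ ∫ ξ, ‖F t ω x ξ‖ ^ 2 ∂ν := integral_nonneg fun _ => by positivity
        linarith [key t ht x]
      integrable_jump := fun t ht x => (h2 x t ht).1
      jump := fun t ht x => by linarith [key t ht x, sq_nonneg ‖B t ω x‖] }

namespace IsRegularPath

variable {T : ℝ≥0} {ν : Measure E} {j : V →L[ℝ] H} {p : ℝ} {k lam K₁ K₁' : ℝ≥0 → ℝ}
  {a : ℝ≥0 → V → StrongDual ℝ V} {b : ℝ≥0 → V → Y} {f : ℝ≥0 → V → E → H}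

theorem isDissipativeFamily (h : IsRegularPath T ν j p k lam K₁ K₁' a b f) {s t : ℝ≥0} (ht : t ≤ T)
    (hmeas : ∀ x, AEStronglyMeasurable (fun r => a r x) (timeMeasure.restrict (Set.Ioc s t)))
    (hk : IntegrableOn k (Set.Iic T) timeMeasure) (hlam : IntegrableOn lam (Set.Iic T) timeMeasure)
    (hK₁ : IntegrableOn K₁ (Set.Iic T) timeMeasure)
    (hK₁' : IntegrableOn K₁' (Set.Iic T) timeMeasure)
    (hle : ∫ r in Set.Ioc s t, K₁' r ∂timeMeasure ≤ 1) :
    IsDissipativeFamily (timeMeasure.restrict (Set.Ioc s t)) j p k lam K₁ K₁' a := by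
  have hsub : Set.Ioc s t ⊆ Set.Iic T := fun r hr => hr.2.trans ht
  exact
    { meas := hmeas
      mono := ae_restrict_of_forall_mem measurableSet_Ioc fun r hr => h.mono r (hsub hr)
      hemi := ae_restrict_of_forall_mem measurableSet_Ioc fun r hr => h.hemi r (hsub hr)
      growth := ae_restrict_of_forall_mem measurableSet_Ioc fun r hr => h.growth r (hsub hr)
      coer := ae_restrict_of_forall_mem measurableSet_Ioc fun r hr => h.coer r (hsub hr)
      integrable_k := hk.mono_set hsub
      integrable_lam := hlam.mono_set hsub
      integrable_K := hK₁.mono_set hsub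
      integrable_K' := hK₁'.mono_set hsub
      integral_K'_le := hle }

theorem norm_integral_diffusion_le [NormedSpace ℝ Y]
    (h : IsRegularPath T ν j p k lam K₁ K₁' a b f) {s t : ℝ≥0} (ht : t ≤ T)
    (hk : IntegrableOn k (Set.Iic T) timeMeasure) (x : V) :
    ‖∫ r in Set.Ioc s t, b r x ∂timeMeasure‖
      ≤ (∫ r in Set.Ioc s t, (k r + 1) ∂timeMeasure) * √(1 + ‖x‖ ^ p) := by
  have hsub : Set.Ioc s t ⊆ Set.Iic T := fun r hr => hr.2.trans ht
  have hfin : timeMeasure (Set.Ioc s t) ≠ ∞ := by rw [timeMeasure_Ioc]; exact ENNReal.ofReal_ne_top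
  rw [← integral_mul_const]
  refine norm_integral_le_of_norm_le
    (((hk.mono_set hsub).add (integrableOn_const hfin)).mul_const _) ?_
  refine ae_restrict_of_forall_mem measurableSet_Ioc fun r hr => ?_
  have hx : 0 < 1 + ‖x‖ ^ p := by positivity
  have h1 := h.diffusion r (hsub hr) x
  have hR : 0 < √(1 + ‖x‖ ^ p) := Real.sqrt_pos.2 hx
  have hR2 : √(1 + ‖x‖ ^ p) ^ 2 = 1 + ‖x‖ ^ p := Real.sq_sqrt hx.le
  -- `‖b‖ ≤ ‖b‖² / R + R` with `R = √(1 + ‖x‖ ^ p)`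
  rw [← hR2] at h1
  have h2 : ‖b r x‖ * √(1 + ‖x‖ ^ p) ≤ ‖b r x‖ ^ 2 + √(1 + ‖x‖ ^ p) ^ 2 := by
    nlinarith [sq_nonneg (‖b r x‖ - √(1 + ‖x‖ ^ p)), sq_nonneg ‖b r x‖]
  have h3 : ‖b r x‖ * √(1 + ‖x‖ ^ p) ≤ (k r + 1) * √(1 + ‖x‖ ^ p) * √(1 + ‖x‖ ^ p) := by
    nlinarith
  exact le_of_mul_le_mul_right h3 hR

theorem norm_integral_jump_le
    (h : IsRegularPath T ν j p k lam K₁ K₁' a b f) {s t : ℝ≥0} (ht : t ≤ T)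
    (hk : IntegrableOn k (Set.Iic T) timeMeasure) {C : Set E} (hC : ν C ≠ ∞) (x : V) :
    ‖∫ r in Set.Ioc s t, (∫ ξ in C, f r x ξ ∂ν) ∂timeMeasure‖
      ≤ (∫ r in Set.Ioc s t, (k r + ν.real C) ∂timeMeasure) * √(1 + ‖x‖ ^ p) := by
  have hsub : Set.Ioc s t ⊆ Set.Iic T := fun r hr => hr.2.trans ht
  have hfin : timeMeasure (Set.Ioc s t) ≠ ∞ := by rw [timeMeasure_Ioc]; exact ENNReal.ofReal_ne_top
  rw [← integral_mul_const]
  refine norm_integral_le_of_norm_le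
    (((hk.mono_set hsub).add (integrableOn_const hfin)).mul_const _) ?_
  refine ae_restrict_of_forall_mem measurableSet_Ioc fun r hr => ?_
  have hx : 0 < 1 + ‖x‖ ^ p := by positivity
  have hR : 0 < √(1 + ‖x‖ ^ p) := Real.sqrt_pos.2 hx
  have hR2 : √(1 + ‖x‖ ^ p) ^ 2 = 1 + ‖x‖ ^ p := Real.sq_sqrt hx.le
  set R := √(1 + ‖x‖ ^ p)
  -- `‖f‖ ≤ ‖f‖² / R + R`, where the right side is integrable over `C` as `ν C` is finite
  have hi := h.integrable_jump r (hsub hr) x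
  have hi1 : Integrable (fun ξ => ‖f r x ξ‖ ^ 2 / R) (ν.restrict C) := hi.integrableOn.div_const R
  have hi2 : Integrable (fun _ : E => R) (ν.restrict C) := integrableOn_const hC
  have h1 : ‖∫ ξ in C, f r x ξ ∂ν‖ ≤ ∫ ξ in C, (‖f r x ξ‖ ^ 2 / R + R) ∂ν := by
    refine norm_integral_le_of_norm_le (hi1.add hi2) (Eventually.of_forall fun ξ => ?_)
    have e1 : ‖f r x ξ‖ * R ≤ (‖f r x ξ‖ ^ 2 / R + R) * R := by
      have : (‖f r x ξ‖ ^ 2 / R + R) * R = ‖f r x ξ‖ ^ 2 + R ^ 2 := by field_simp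
      rw [this]
      nlinarith [sq_nonneg (‖f r x ξ‖ - R), sq_nonneg ‖f r x ξ‖, sq_nonneg R]
    exact le_of_mul_le_mul_right e1 hR
  rw [integral_add hi1 hi2, setIntegral_const, integral_div, smul_eq_mul] at h1
  have h2 : ∫ ξ in C, ‖f r x ξ‖ ^ 2 ∂ν ≤ k r * R ^ 2 := by
    rw [hR2]
    exact (setIntegral_le_integral hi (Eventually.of_forall fun _ => by positivity)).trans
      (h.jump r (hsub hr) x)
  have h3 : (∫ ξ in C, ‖f r x ξ‖ ^ 2 ∂ν) / R ≤ k r * R := by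
    rw [div_le_iff₀ hR]; nlinarith
  linarith

end IsRegularPath

end RegularPath

/-! ### One random step of the scheme -/

section Moments

theorem enorm_rpow_eq_ofReal {V : Type*} [NormedAddCommGroup V] {p : ℝ} (hp : 0 ≤ p) (x : V) :
    ‖x‖ₑ ^ p = ENNReal.ofReal (‖x‖ ^ p) := by
  rw [← ofReal_norm, ENNReal.ofReal_rpow_of_nonneg (norm_nonneg _) hp]

variable {Ω V G : Type*} {mΩ : MeasurableSpace Ω} {P : Measure Ω} [NormedAddCommGroup V]
  [MeasurableSpace V] [NormedAddCommGroup G]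

theorem memLp_two_of_norm_le_mul_sqrt [BorelSpace V] [IsFiniteMeasure P] {p : ℝ} (hp : 0 ≤ p)
    {u : Ω → V} (hu : Measurable u) (hup : ∫⁻ ω, ‖u ω‖ₑ ^ p ∂P < ∞) {f : Ω → G} {C : ℝ}
    (hf : AEStronglyMeasurable f P) (hle : ∀ᵐ ω ∂P, ‖f ω‖ ≤ C * √(1 + ‖u ω‖ ^ p)) :
    MemLp f 2 P := by
  have hm : Measurable fun ω => ‖u ω‖ ^ p := hu.norm.pow_const p
  have hi : Integrable (fun ω => ‖u ω‖ ^ p) P := by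
    refine ⟨hm.aestronglyMeasurable, ?_⟩
    rw [hasFiniteIntegral_iff_ofReal (Eventually.of_forall fun _ => by positivity)]
    simpa only [enorm_rpow_eq_ofReal hp] using hup
  have hg : MemLp (fun ω => √(1 + ‖u ω‖ ^ p)) 2 P := by
    rw [memLp_two_iff_integrable_sq (hm.const_add 1).sqrt.aestronglyMeasurable]
    refine ((integrable_const (1 : ℝ)).add hi).congr (Eventually.of_forall fun ω => ?_)
    have h0 : 0 ≤ 1 + ‖u ω‖ ^ p := by positivity
    exact (Real.sq_sqrt h0).symm
  refine hg.of_le_mul (c := C) hf ?_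
  filter_upwards [hle] with ω h
  rwa [Real.norm_of_nonneg (Real.sqrt_nonneg _)]

theorem norm_le_sqrt_one_add_rpow {p x : ℝ} (hp : 2 ≤ p) (hx : 0 ≤ x) : x ≤ √(1 + x ^ p) :=
  Real.le_sqrt_of_sq_le (sq_le_one_add_rpow hp hx)

end Moments

section Step

variable {V H Ω : Type*} [NormedAddCommGroup V] [NormedSpace ℝ V]
  [TopologicalSpace.SeparableSpace V] [MeasurableSpace V] [BorelSpace V]
  [NormedAddCommGroup H] [InnerProductSpace ℝ H] [MeasurableSpace H] [BorelSpace H]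
  {mΩ : MeasurableSpace Ω} {P : Measure Ω} [IsFiniteMeasure P] {𝓕 : Filtration ℝ≥0 mΩ} {T : ℝ≥0}

/-- One implicit step with random data `h`: the solution is adapted, and coercivity bounds its
`p`-th moment in `V` by the second moment of `h`. -/
theorem exists_implicit_step
    (hrefl : Function.Surjective (NormedSpace.inclusionInDoubleDual ℝ V))
    {j : V →L[ℝ] H} (hj : Function.Injective j) (h𝓕 : UsualConditions P 𝓕)
    {A : ℝ≥0 → Ω → V → StrongDual ℝ V} (hA : ProgressivelyMeasurableCoeff 𝓕 T A)
    {p : ℝ} (hp : 1 ≤ p) {k lam K K' : ℝ≥0 → ℝ} {s t : ℝ≥0} (ht : t ≤ T)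
    (hdis : ∀ᵐ ω ∂P, IsDissipativeFamily (timeMeasure.restrict (Set.Ioc s t)) j p k lam K K'
      (fun r => A r ω))
    (hlam : 0 < ∫ r in Set.Ioc s t, lam r ∂timeMeasure)
    {h : Ω → H} (hm : Measurable[𝓕 t] h) (h2 : MemLp h 2 P) :
    ∃ u : Ω → V, Measurable[𝓕 t] u ∧ ∫⁻ ω, ‖u ω‖ₑ ^ p ∂P < ∞ ∧
      ∀ᵐ ω ∂P, implicitOp (timeMeasure.restrict (Set.Ioc s t)) j (fun r => A r ω) (u ω)
        = pivot j (h ω) := by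
  classical
  let μ := timeMeasure.restrict (Set.Ioc s t)
  let S : Set Ω := {ω | IsDissipativeFamily μ j p k lam K K' (fun r => A r ω)}
  have hS : MeasurableSet[𝓕 t] S := by
    have h0 : MeasurableSet[𝓕 0] Sᶜ := h𝓕.2 _ hdis
    exact ((𝓕.mono zero_le) _ h0).of_compl
  have hex : ∀ ω ∈ S, ∃ x, implicitOp μ j (fun r => A r ω) x = pivot j (h ω) := fun ω hω =>
    IsDissipativeFamily.exists_implicitOp_eq hω hrefl hp hlam (h ω)
  let u : Ω → V := fun ω => if hω : ω ∈ S then (hex ω hω).choose else 0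
  have hu : ∀ ω ∈ S, implicitOp μ j (fun r => A r ω) (u ω) = pivot j (h ω) := fun ω hω => by
    simp only [u, dif_pos hω]
    exact (hex ω hω).choose_spec
  have hsep : TopologicalSpace.SeparableSpace (StrongDual ℝ V) :=
    separableSpace_strongDual_of_reflexive hrefl
  have hsec : SecondCountableTopology (StrongDual ℝ V) :=
    UniformSpace.secondCountable_of_separable _
  have hint := hA.measurable_integral (a := s) ht
  have hum : Measurable[𝓕 t] u := by
    refine IsMonotoneHemicontinuous.measurable_solution (m := 𝓕 t) hrefl
      (y := fun ω => pivot j (h ω)) hS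
      (fun ω hω => IsDissipativeFamily.isMonotoneHemicontinuous hω (by linarith))
      (fun ω hω => IsDissipativeFamily.implicitOp_injective hω hj) hu
      (fun ω hω => by simp only [u, dif_neg hω]) (fun z v => ?_) (fun v => ?_)
    · let : MeasurableSpace Ω := 𝓕 t
      have h1 : Measurable fun ω => ∫ r, A r ω z ∂μ :=
        hint.comp (f := fun ω => (ω, z)) (by fun_prop)
      have h2 : Measurable fun f : StrongDual ℝ V => f v :=
        (ContinuousLinearMap.apply ℝ ℝ v).continuous.measurable
      exact measurable_const.sub (h2.comp h1)
    · have h1 : Measurable fun x : H => inner ℝ x (j v) := by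
        have : Continuous fun x : H => inner ℝ x (j v) := by fun_prop
        exact this.measurable
      exact h1.comp hm
  refine ⟨u, hum, ?_, hdis.mono hu⟩
  set Λ := ∫ r, lam r ∂μ
  set κ := ∫ r, K r ∂μ
  have hi : Integrable (fun ω => (κ + ‖h ω‖ ^ 2) / Λ) P := by
    have h3 := (memLp_two_iff_integrable_sq_norm h2.1).1 h2
    exact ((integrable_const κ).add h3).div_const Λ
  refine lt_of_le_of_lt (lintegral_mono_ae ?_) hi.lintegral_lt_top
  filter_upwards [hdis] with ω hω
  rw [enorm_rpow_eq_ofReal (by linarith)]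
  refine ENNReal.ofReal_le_ofReal ?_
  rw [le_div_iff₀ hlam, mul_comm]
  exact IsDissipativeFamily.mul_norm_rpow_le hω (hu ω hω)

end Step

/-! ### The noise terms -/

section Noise

variable {V H U E Ω : Type*} [NormedAddCommGroup V] [MeasurableSpace V] [BorelSpace V]
  [NormedAddCommGroup H] [InnerProductSpace ℝ H] [MeasurableSpace H] [BorelSpace H]
  [TopologicalSpace.SeparableSpace H] [NormedAddCommGroup U] [InnerProductSpace ℝ U]
  [MeasurableSpace E] {mΩ : MeasurableSpace Ω} {P : Measure Ω} {𝓕 : Filtration ℝ≥0 mΩ} {T : ℝ≥0}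
  {d : ℕ∞}

/-- For a Hilbert-Schmidt valued integrand `S` known at time `s`, the increment of the truncated
Wiener process gives a square integrable random variable known at time `t`. -/
theorem measurable_memLp_truncatedWiener {g : HilbertBasis {k : ℕ // (k : ℕ∞) < d} ℝ U}
    {W : ℝ≥0 → U → Ω → ℝ} (hW : IsCylindricalWiener P 𝓕 T W) (l : ℕ) {s t : ℝ≥0} (hst : s ≤ t)
    (ht : t ≤ T) {S : Ω → HilbertSchmidt g H} (hS : Measurable[𝓕 s] S) (hS2 : MemLp S 2 P) :
    Measurable[𝓕 t] (fun ω => (S ω).toCLM (truncatedWiener g W l t ω - truncatedWiener g W l s ω)) ∧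
    MemLp (fun ω => (S ω).toCLM (truncatedWiener g W l t ω - truncatedWiener g W l s ω)) 2 P := by
  have hsecH : SecondCountableTopology H := UniformSpace.secondCountable_of_separable _
  have heq : (fun ω => (S ω).toCLM (truncatedWiener g W l t ω - truncatedWiener g W l s ω))
      = fun ω => ∑ k ∈ Finset.range l, if h : (k : ℕ∞) < d then
        (W t (g ⟨k, h⟩) ω - W s (g ⟨k, h⟩) ω) • (S ω).toCLM (g ⟨k, h⟩) else 0 := by
    funext ω
    simp only [truncatedWiener]
    rw [← Finset.sum_sub_distrib, map_sum]
    refine Finset.sum_congr rfl fun k _ => ?_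
    split_ifs with h
    · rw [← sub_smul, map_smul]
    · simp
  have hSk : ∀ k, Measurable[𝓕 s] fun ω => (S ω).toCLM (g k) := fun k =>
    ((HilbertSchmidt.evalBasis g k).continuous.measurable.comp hS :)
  have hWm : ∀ h, Measurable[𝓕 t] fun ω => W t h ω - W s h ω := fun h =>
    Measurable.sub (hW.adapted t ht h)
      ((hW.adapted s (hst.trans ht) h).mono (𝓕.mono hst) le_rfl)
  rw [heq]
  constructor
  · refine Finset.measurable_fun_sum _ fun k _ => ?_
    split_ifs with h
    · exact Measurable.smul (hWm _) ((hSk _).mono (𝓕.mono hst) le_rfl)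
    · exact measurable_const
  · refine memLp_finsetSum _ fun k _ => ?_
    split_ifs with h
    · refine memLp_two_smul_of_indep ?_ (𝓕.le s) (hW.indep s t hst ht) ?_ (hSk ⟨k, h⟩)
        (memLp_two_of_hasLaw_gaussian (hW.law s t hst ht _)) ?_
      · exact iSup_le fun h' => ((hWm h').mono (𝓕.le t) le_rfl).comap_le
      · exact Measurable.of_comap_le (le_iSup (fun h' : U =>
          MeasurableSpace.comap (fun ω => W t h' ω - W s h' ω) inferInstance) (g ⟨k, h⟩))
      · refine hS2.mono ((hSk _).mono (𝓕.le s) le_rfl).aestronglyMeasurable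
          (Eventually.of_forall fun ω => HilbertSchmidt.norm_toCLM_basis_le g _ _)
    · exact MemLp.zero'

section Compensated

variable {X : Type*} [NormedAddCommGroup X]
  {ν : Measure E} {M : Measure (ℝ≥0 × E)} {s t : ℝ≥0} {r : ℕ} {cell : Fin r → Set E}

theorem integrableOn_sum_indicator (hc : ∀ i, MeasurableSet (cell i))
    (hM : ∀ i, M (Set.Ioc s t ×ˢ cell i) < ∞) (c : Fin r → X) :
    IntegrableOn (fun z : ℝ≥0 × E => ∑ i, (cell i).indicator (fun _ => c i) z.2)
      (Set.Ioc s t ×ˢ Set.univ) M := by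
  refine integrable_finsetSum _ fun i _ => ?_
  have h1 : (fun z : ℝ≥0 × E => (cell i).indicator (fun _ => c i) z.2)
      = (Set.univ ×ˢ cell i).indicator (fun _ => c i) := by
    classical
    funext z; simp [Set.indicator_apply]
  rw [h1, integrable_indicator_iff (MeasurableSet.univ.prod (hc i))]
  refine integrableOn_const ?_
  rw [Measure.restrict_apply (MeasurableSet.univ.prod (hc i)), Set.prod_inter_prod,
    Set.univ_inter, Set.inter_univ]
  exact (hM i).ne

variable [NormedSpace ℝ X]

theorem setIntegral_sum_indicator [CompleteSpace X] (hc : ∀ i, MeasurableSet (cell i))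
    (hM : ∀ i, M (Set.Ioc s t ×ˢ cell i) < ∞) (c : Fin r → X) :
    ∫ z in Set.Ioc s t ×ˢ Set.univ, ∑ i, (cell i).indicator (fun _ => c i) z.2 ∂M
      = ∑ i, (M (Set.Ioc s t ×ˢ cell i)).toReal • c i := by
  have h1 : ∀ i, (fun z : ℝ≥0 × E => (cell i).indicator (fun _ => c i) z.2)
      = (Set.univ ×ˢ cell i).indicator (fun _ => c i) := fun i => by
    classical
    funext z; simp [Set.indicator_apply]
  have h2 : ∀ i, (M.restrict (Set.Ioc s t ×ˢ Set.univ)) (Set.univ ×ˢ cell i)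
      = M (Set.Ioc s t ×ˢ cell i) := fun i => by
    rw [Measure.restrict_apply (MeasurableSet.univ.prod (hc i)), Set.prod_inter_prod,
      Set.univ_inter, Set.inter_univ]
  rw [integral_finsetSum _ fun i _ => ?_]
  · refine Finset.sum_congr rfl fun i _ => ?_
    rw [h1, integral_indicator_const _ (MeasurableSet.univ.prod (hc i)), measureReal_def, h2]
  · rw [h1, integrable_indicator_iff (MeasurableSet.univ.prod (hc i))]
    refine integrableOn_const ?_
    rw [h2]
    exact (hM i).ne

variable [SFinite ν]

theorem timeMeasure_prod_Ioc_lt_top {C : Set E} (hC : ν C < ∞) :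
    (timeMeasure.prod ν) (Set.Ioc s t ×ˢ C) < ∞ := by
  rw [Measure.prod_prod, timeMeasure_Ioc]
  exact ENNReal.mul_lt_top ENNReal.ofReal_lt_top hC

/-- The compensated integral of a step function. -/
theorem compensatedIntegral_sum_indicator [CompleteSpace X] (hc : ∀ i, MeasurableSet (cell i))
    (hν : ∀ i, ν (cell i) < ∞)
    (hM : ∀ i, M (Set.Ioc s t ×ˢ cell i) < ∞) (c : Fin r → X) :
    compensatedIntegral ν M s t (fun ξ => ∑ i, (cell i).indicator (fun _ => c i) ξ)
      = ∑ i, ((M (Set.Ioc s t ×ˢ cell i)).toReal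
          - ((timeMeasure.prod ν) (Set.Ioc s t ×ˢ cell i)).toReal) • c i := by
  rw [compensatedIntegral, setIntegral_sum_indicator hc hM,
    setIntegral_sum_indicator hc fun i => timeMeasure_prod_Ioc_lt_top (hν i),
    ← Finset.sum_sub_distrib]
  simp_rw [sub_smul]

end Compensated

theorem IsPoissonRandomMeasure.ae_forall_lt_top {ν : Measure E} [SFinite ν]
    {N : Ω → Measure (ℝ≥0 × E)} (hN : IsPoissonRandomMeasure P 𝓕 T ν N) {s t : ℝ≥0} (ht : t ≤ T)
    {r : ℕ} {cell : Fin r → Set E} (hc : ∀ i, MeasurableSet (cell i)) (hν : ∀ i, ν (cell i) < ∞) :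
    ∀ᵐ ω ∂P, ∀ i, N ω (Set.Ioc s t ×ˢ cell i) < ∞ := by
  rw [ae_all_iff]
  exact fun i => ae_lt_top_of_hasLaw_poisson (hN.law _ (measurableSet_Ioc.prod (hc i))
    (Set.prod_mono (fun r hr => hr.2.trans ht) (Set.subset_univ _))
    (timeMeasure_prod_Ioc_lt_top (hν i)).ne)

/-- For cell weights known at time `s`, the compensated jumps in `(s, t]` give a square integrable
random variable known at time `t`. -/
theorem measurable_memLp_jumps {ν : Measure E} [SFinite ν] [IsProbabilityMeasure P]
    {N : Ω → Measure (ℝ≥0 × E)} (hN : IsPoissonRandomMeasure P 𝓕 T ν N) {s t : ℝ≥0} (hst : s ≤ t)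
    (ht : t ≤ T) {r : ℕ} {cell : Fin r → Set E} (hc : ∀ i, MeasurableSet (cell i))
    (hν : ∀ i, ν (cell i) < ∞) {c : Fin r → Ω → H} (hcm : ∀ i, Measurable[𝓕 s] (c i))
    (hc2 : ∀ i, MemLp (c i) 2 P) :
    Measurable[𝓕 t] (fun ω => ∑ i, ((N ω (Set.Ioc s t ×ˢ cell i)).toReal
      - ((timeMeasure.prod ν) (Set.Ioc s t ×ˢ cell i)).toReal) • c i ω) ∧
    MemLp (fun ω => ∑ i, ((N ω (Set.Ioc s t ×ˢ cell i)).toReal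
      - ((timeMeasure.prod ν) (Set.Ioc s t ×ˢ cell i)).toReal) • c i ω) 2 P := by
  have hsecH : SecondCountableTopology H := UniformSpace.secondCountable_of_separable _
  have hsub : ∀ C : Set E, Set.Ioc s t ×ˢ C ⊆ Set.Iic t ×ˢ Set.univ := fun C =>
    Set.prod_mono (fun r hr => hr.2) (Set.subset_univ _)
  constructor
  · refine Finset.measurable_fun_sum _ fun i _ => ?_
    refine Measurable.smul (Measurable.sub ?_ measurable_const)
      ((hcm i).mono (𝓕.mono hst) le_rfl)
    exact ENNReal.measurable_toReal.comp
      (hN.adapted t ht _ (measurableSet_Ioc.prod (hc i)) (hsub _))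
  · refine memLp_finsetSum _ fun i _ => ?_
    refine memLp_two_smul_of_indep ?_ (𝓕.le s) (hN.indep_past s t hst ht) ?_ (hcm i)
      (MemLp.sub (memLp_two_of_hasLaw_poisson (hN.law _ (measurableSet_Ioc.prod (hc i))
        ((hsub _).trans (Set.prod_mono (Set.Iic_subset_Iic.2 ht) le_rfl))
        (timeMeasure_prod_Ioc_lt_top (hν i)).ne)) (memLp_const _)) (hc2 i)
    · refine iSup₂_le fun S hS => ?_
      refine ((hN.adapted t ht S hS.1 (hS.2.trans ?_)).mono (𝓕.le t) le_rfl).comap_le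
      exact Set.prod_mono (fun r hr => hr.2) le_rfl
    · refine Measurable.sub ?_ measurable_const
      refine ENNReal.measurable_toReal.comp (Measurable.of_comap_le ?_)
      exact le_iSup₂ (f := fun (S : Set (ℝ≥0 × E))
        (_ : S ∈ {S : Set (ℝ≥0 × E) | MeasurableSet S ∧ S ⊆ Set.Ioc s t ×ˢ Set.univ}) =>
        MeasurableSpace.comap (fun ω => N ω S) inferInstance) (Set.Ioc s t ×ˢ cell i)
        ⟨measurableSet_Ioc.prod (hc i), Set.prod_mono le_rfl (Set.subset_univ _)⟩

end Noise

/-! ### The implicit scheme without projection -/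

section Grid

theorem gridPt_zero (T : ℝ≥0) (m : ℕ) : gridPt T m 0 = 0 := by simp [gridPt]

theorem gridPt_mono (T : ℝ≥0) (m : ℕ) : Monotone (gridPt T m) := fun i k hik => by
  unfold gridPt
  gcongr

theorem gridPt_le {T : ℝ≥0} {m i : ℕ} (hi : i ≤ m) : gridPt T m i ≤ T := by
  rcases Nat.eq_zero_or_pos m with rfl | hm
  · simp [gridPt]
  · refine (gridPt_mono T m hi).trans (le_of_eq ?_)
    have : (m : ℝ≥0) ≠ 0 := by positivity
    unfold gridPt
    field_simp

theorem gridPt_sub_gridPt (T : ℝ≥0) (m : ℕ) {i : ℕ} (hi : 1 ≤ i) :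
    (gridPt T m i : ℝ) - gridPt T m (i - 1) = stepSize T m := by
  obtain ⟨n, rfl⟩ := Nat.exists_eq_add_of_le' hi
  rw [Nat.add_sub_cancel]
  unfold gridPt stepSize
  push_cast
  ring

theorem stepSize_pos {T : ℝ≥0} (hT : 0 < T) {m : ℕ} (hm : 0 < m) : 0 < stepSize T m := by
  unfold stepSize
  positivity

theorem setIntegral_grid_pos {T : ℝ≥0} (hT : 0 < T) {lam : ℝ≥0 → ℝ} (hlam : PosIntegrable T lam)
    {m i : ℕ} (hi : 1 ≤ i) (him : i ≤ m) :
    0 < ∫ r in Set.Ioc (gridPt T m (i - 1)) (gridPt T m i), lam r ∂timeMeasure := by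
  have hsub : Set.Ioc (gridPt T m (i - 1)) (gridPt T m i) ⊆ Set.Iic T :=
    fun r hr => hr.2.trans (gridPt_le him)
  rw [setIntegral_pos_iff_support_of_nonneg_ae
    (ae_restrict_of_forall_mem measurableSet_Ioc fun r hr => (hlam.1 r (hsub hr)).le)
    (hlam.2.mono_set hsub)]
  have hsupp : Function.support lam ∩ Set.Ioc (gridPt T m (i - 1)) (gridPt T m i)
      = Set.Ioc (gridPt T m (i - 1)) (gridPt T m i) :=
    Set.inter_eq_right.2 fun r hr => (hlam.1 r (hsub hr)).ne'
  rw [hsupp, timeMeasure_Ioc, gridPt_sub_gridPt T m hi, ENNReal.ofReal_pos]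
  exact stepSize_pos hT (hi.trans him)

/-- By absolute continuity of the integral, an integrable function has small integrals over all
cells of a sufficiently fine grid. -/
theorem exists_forall_setIntegral_grid_le {T : ℝ≥0} {K : ℝ≥0 → ℝ}
    (hK : IntegrableOn K (Set.Iic T) timeMeasure) :
    ∃ m₀ : ℕ, 1 ≤ m₀ ∧ ∀ m, m₀ ≤ m → ∀ i, 1 ≤ i → i ≤ m →
      ∫ r in Set.Ioc (gridPt T m (i - 1)) (gridPt T m i), K r ∂timeMeasure ≤ 1 := by
  by_contra hcon
  push Not at hcon
  choose m hm i hi him hlt using fun n : ℕ => hcon (n + 1) (by omega)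
  let s : ℕ → Set ℝ≥0 := fun n => Set.Ioc (gridPt T (m n) (i n - 1)) (gridPt T (m n) (i n))
  have hsub : ∀ n, s n ⊆ Set.Iic T := fun n r hr => hr.2.trans (gridPt_le (him n))
  have hres : ∀ n, (timeMeasure.restrict (Set.Iic T)).restrict (s n) = timeMeasure.restrict (s n) :=
    fun n => Measure.restrict_restrict_of_subset (hsub n)
  have hlim : Tendsto ((timeMeasure.restrict (Set.Iic T)) ∘ s) atTop (𝓝 0) := by
    have h1 : Tendsto (fun n : ℕ => ENNReal.ofReal ((T : ℝ) / (n + 1 : ℕ))) atTop (𝓝 0) := by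
      have h2 : Tendsto (fun n : ℕ => (T : ℝ) / (n + 1 : ℕ)) atTop (𝓝 0) :=
        (tendsto_add_atTop_iff_nat 1).2 (tendsto_const_div_atTop_nhds_zero_nat (T : ℝ))
      simpa using ENNReal.tendsto_ofReal h2
    refine tendsto_of_tendsto_of_tendsto_of_le_of_le tendsto_const_nhds h1
      (fun _ => zero_le) fun n => ?_
    refine (Measure.restrict_apply_le _ _).trans ?_
    rw [timeMeasure_Ioc, gridPt_sub_gridPt T (m n) (hi n)]
    refine ENNReal.ofReal_le_ofReal ?_
    unfold stepSize
    have := hm n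
    gcongr
  have hz := Integrable.tendsto_setIntegral_nhds_zero hK hlim
  simp_rw [hres] at hz
  obtain ⟨n, hn⟩ := (hz.eventually (gt_mem_nhds one_pos)).exists
  exact absurd hn (not_lt.2 (hlt n).le)

end Grid

section Scheme

theorem compensatedIntegral_zero {X E : Type*} [NormedAddCommGroup X] [NormedSpace ℝ X]
    [MeasurableSpace E] (ν : Measure E) (M : Measure (ℝ≥0 × E)) (s t : ℝ≥0) :
    compensatedIntegral ν M s t (fun _ => (0 : X)) = 0 := by
  simp [compensatedIntegral]

theorem JumpDiscretization.measure_cell_lt_top {E : Type*} [MetricSpace E] [MeasurableSpace E]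
    {ν : Measure E} (D : JumpDiscretization ν) (l : ℕ) (i : Fin (D.r l)) :
    ν (D.cell l i) < ∞ := by
  refine lt_of_le_of_lt (measure_mono ?_) (D.exhaust_finite l)
  rw [← D.cell_iUnion l]
  exact Set.subset_iUnion _ i

variable {V H U E Ω : Type*} [NormedAddCommGroup V] [NormedSpace ℝ V]
  [NormedAddCommGroup H] [InnerProductSpace ℝ H] [NormedAddCommGroup U] [InnerProductSpace ℝ U]
  [MetricSpace E] [MeasurableSpace E] {mΩ : MeasurableSpace Ω} {d : ℕ∞}

theorem pivot_add (j : V →L[ℝ] H) (x y : H) : pivot j (x + y) = pivot j x + pivot j y := by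
  ext v
  simp only [add_apply, pivot_apply, inner_add_left]

/-- The explicit part of the `i`-th equation of the scheme: the previous value `w` (the initial
value, for `i = 1`) and the noise terms. -/
noncomputable def explicitData (T : ℝ≥0) (j : V →L[ℝ] H)
    (g : HilbertBasis {k : ℕ // (k : ℕ∞) < d} ℝ U) {ν : Measure E} (D : JumpDiscretization ν)
    (W : ℝ≥0 → U → Ω → ℝ) (N : Ω → Measure (ℝ≥0 × E)) (B : ℝ≥0 → Ω → V → HilbertSchmidt g H)
    (F : ℝ≥0 → Ω → V → E → H) (ζ : Ω → H) (m l i : ℕ) (ω : Ω) (w : V) : H :=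
  (if i = 1 then ζ ω else j w)
    + (precedingMean T m B i ω w).toCLM
        (truncatedWiener g W l (gridPt T m i) ω - truncatedWiener g W l (gridPt T m (i - 1)) ω)
    + compensatedIntegral ν (N ω) (gridPt T m (i - 1)) (gridPt T m i) (jumpMean D T m l F i ω w)

theorem explicitData_one (T : ℝ≥0) (j : V →L[ℝ] H)
    (g : HilbertBasis {k : ℕ // (k : ℕ∞) < d} ℝ U) {ν : Measure E} (D : JumpDiscretization ν)
    (W : ℝ≥0 → U → Ω → ℝ) (N : Ω → Measure (ℝ≥0 × E)) (B : ℝ≥0 → Ω → V → HilbertSchmidt g H)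
    (F : ℝ≥0 → Ω → V → E → H) (ζ : Ω → H) (m l : ℕ) (ω : Ω) (w : V) :
    explicitData T j g D W N B F ζ m l 1 ω w = ζ ω := by
  have h1 : precedingMean T m B 1 ω w = 0 := if_pos le_rfl
  have h2 : jumpMean D T m l F 1 ω w = fun _ => 0 := funext fun ξ => if_pos le_rfl
  have h3 : ∀ u : U, (0 : HilbertSchmidt g H).toCLM u = 0 := fun u => rfl
  rw [explicitData, h1, h2, h3, compensatedIntegral_zero, if_pos rfl, add_zero, add_zero]

/-- The equations of the scheme as equations for the operators of the implicit steps. -/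
theorem implicit_equation_iff {T : ℝ≥0} (hT : 0 < T) {j : V →L[ℝ] H}
    {g : HilbertBasis {k : ℕ // (k : ℕ∞) < d} ℝ U} {ν : Measure E} {D : JumpDiscretization ν}
    {W : ℝ≥0 → U → Ω → ℝ} {N : Ω → Measure (ℝ≥0 × E)}
    {A : ℝ≥0 → Ω → V → StrongDual ℝ V} {B : ℝ≥0 → Ω → V → HilbertSchmidt g H}
    {F : ℝ≥0 → Ω → V → E → H} {ζ : Ω → H} {m l i : ℕ} (hi : 1 ≤ i) (him : i ≤ m) {ω : Ω} {x w : V} :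
    pivot j (j x) = pivot j (if i = 1 then ζ ω else j w) + stepSize T m • currentMean T m A i ω x
      + pivot j ((precedingMean T m B i ω w).toCLM
          (truncatedWiener g W l (gridPt T m i) ω - truncatedWiener g W l (gridPt T m (i - 1)) ω))
      + pivot j (compensatedIntegral ν (N ω) (gridPt T m (i - 1)) (gridPt T m i)
          (jumpMean D T m l F i ω w)) ↔
    implicitOp (timeMeasure.restrict (Set.Ioc (gridPt T m (i - 1)) (gridPt T m i))) j
      (fun r => A r ω) x = pivot j (explicitData T j g D W N B F ζ m l i ω w) := by
  have h1 : stepSize T m • currentMean T m A i ω x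
      = ∫ r in Set.Ioc (gridPt T m (i - 1)) (gridPt T m i), A r ω x ∂timeMeasure := by
    rw [currentMean, if_neg (by omega), smul_smul,
      mul_inv_cancel₀ (stepSize_pos hT (hi.trans him)).ne', one_smul]
  rw [h1, implicitOp, explicitData, pivot_add, pivot_add, sub_eq_iff_eq_add]
  refine iff_of_eq (congrArg _ ?_)
  abel

end Scheme

section Core

variable {V H U E Ω : Type*} [NormedAddCommGroup V] [NormedSpace ℝ V]
  [MeasurableSpace V] [BorelSpace V]
  [NormedAddCommGroup H] [InnerProductSpace ℝ H] [CompleteSpace H]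
  [TopologicalSpace.SeparableSpace H] [MeasurableSpace H] [BorelSpace H]
  [NormedAddCommGroup U] [InnerProductSpace ℝ U]
  [MetricSpace E] [MeasurableSpace E] {ν : Measure E} [SFinite ν]
  {mΩ : MeasurableSpace Ω} {P : Measure Ω} [IsProbabilityMeasure P] {𝓕 : Filtration ℝ≥0 mΩ}
  {T : ℝ≥0} {d : ℕ∞}

/-- The explicit data of the `i`-th equation are square integrable and known at time `t_i`. -/
theorem exists_measurable_memLp_explicitData {j : V →L[ℝ] H}
    {W : ℝ≥0 → U → Ω → ℝ} (hW : IsCylindricalWiener P 𝓕 T W)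
    {N : Ω → Measure (ℝ≥0 × E)} (hN : IsPoissonRandomMeasure P 𝓕 T ν N)
    {g : HilbertBasis {k : ℕ // (k : ℕ∞) < d} ℝ U} {D : JumpDiscretization ν}
    {A : ℝ≥0 → Ω → V → StrongDual ℝ V}
    {B : ℝ≥0 → Ω → V → HilbertSchmidt g H} (hB : ProgressivelyMeasurableCoeff 𝓕 T B)
    {F : ℝ≥0 → Ω → V → E → H} (hF : PredictableCoeff 𝓕 T F) {p : ℝ} (hp : 2 ≤ p)
    {k lam K₁ K₁' : ℝ≥0 → ℝ} (hk : IntegrableOn k (Set.Iic T) timeMeasure)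
    (hreg : ∀ᵐ ω ∂P, IsRegularPath T ν j p k lam K₁ K₁' (fun t => A t ω) (fun t => B t ω)
        (fun t => F t ω))
    {ζ : Ω → H} (hζ : Measurable[𝓕 0] ζ) (hζ2 : MemLp ζ 2 P) {m l i : ℕ} (hi : 1 ≤ i) (him : i ≤ m)
    {w : Ω → V} (hw : i ≠ 1 → Measurable[𝓕 (gridPt T m (i - 1))] w ∧ ∫⁻ ω, ‖w ω‖ₑ ^ p ∂P < ∞) :
    ∃ h : Ω → H, Measurable[𝓕 (gridPt T m i)] h ∧ MemLp h 2 P ∧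
      ∀ᵐ ω ∂P, explicitData T j g D W N B F ζ m l i ω (w ω) = h ω := by
  rcases eq_or_ne i 1 with rfl | hi1
  · exact ⟨ζ, hζ.mono (𝓕.mono zero_le) le_rfl, hζ2,
      Eventually.of_forall fun ω => explicitData_one ..⟩
  obtain ⟨hwm, hwp⟩ := hw hi1
  have hwm' : Measurable w := hwm.mono (𝓕.le _) le_rfl
  have hsecH : SecondCountableTopology H := UniformSpace.secondCountable_of_separable _
  have hsecS : SecondCountableTopology (HilbertSchmidt g H) :=
    UniformSpace.secondCountable_of_separable _
  have h2i : ¬ i ≤ 1 := by omega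
  have hst : gridPt T m (i - 1) ≤ gridPt T m i := gridPt_mono T m (by omega)
  have hsT : gridPt T m (i - 1) ≤ T := gridPt_le (by omega)
  have htT : gridPt T m i ≤ T := gridPt_le him
  -- the previous value
  have hjw : Measurable[𝓕 (gridPt T m i)] fun ω => j (w ω) :=
    j.continuous.measurable.comp (hwm.mono (𝓕.mono hst) le_rfl)
  have hjw2 : MemLp (fun ω => j (w ω)) 2 P := by
    refine memLp_two_of_norm_le_mul_sqrt (by linarith) hwm' hwp (C := ‖j‖)
      (hjw.mono (𝓕.le _) le_rfl).aestronglyMeasurable (Eventually.of_forall fun ω => ?_)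
    exact (j.le_opNorm _).trans
      (mul_le_mul_of_nonneg_left (norm_le_sqrt_one_add_rpow hp (norm_nonneg _)) (norm_nonneg _))
  have hpair : @Measurable _ _ (𝓕 (gridPt T m (i - 1)))
      ((𝓕 (gridPt T m (i - 1))).prod inferInstance) (fun ω => (ω, w ω)) := by
    let : MeasurableSpace Ω := 𝓕 (gridPt T m (i - 1))
    exact measurable_id.prodMk hwm
  -- the diffusion term
  have hSm : Measurable[𝓕 (gridPt T m (i - 1))] fun ω => precedingMean T m B i ω (w ω) := by
    simp only [precedingMean, if_neg h2i]
    have h1 := (hB.measurable_integral (a := gridPt T m (i - 2)) hsT).comp hpair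
    exact (continuous_const_smul _).measurable.comp h1
  have hS2 : MemLp (fun ω => precedingMean T m B i ω (w ω)) 2 P := by
    refine memLp_two_of_norm_le_mul_sqrt (by linarith) hwm' hwp
      (C := ‖(stepSize T m)⁻¹‖ *
        ∫ r in Set.Ioc (gridPt T m (i - 2)) (gridPt T m (i - 1)), (k r + 1) ∂timeMeasure)
      (hSm.mono (𝓕.le _) le_rfl).aestronglyMeasurable ?_
    filter_upwards [hreg] with ω hω
    rw [precedingMean, if_neg h2i, norm_smul, mul_assoc]
    exact mul_le_mul_of_nonneg_left (hω.norm_integral_diffusion_le hsT hk _) (norm_nonneg _)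
  -- the jump term
  let c : Fin (D.r l) → Ω → H := fun n ω => (stepSize T m * (ν (D.cell l n)).toReal)⁻¹ •
    ∫ s in Set.Ioc (gridPt T m (i - 2)) (gridPt T m (i - 1)),
      (∫ η in D.cell l n, F s ω (w ω) η ∂ν) ∂timeMeasure
  have hcm : ∀ n, Measurable[𝓕 (gridPt T m (i - 1))] (c n) := fun n =>
    (continuous_const_smul _).measurable.comp
      ((hF.measurable_integral (a := gridPt T m (i - 2)) hsT ν (D.cell l n)).comp hpair)
  have hc2 : ∀ n, MemLp (c n) 2 P := fun n => by
    refine memLp_two_of_norm_le_mul_sqrt (by linarith) hwm' hwp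
      (C := ‖(stepSize T m * (ν (D.cell l n)).toReal)⁻¹‖ *
        ∫ r in Set.Ioc (gridPt T m (i - 2)) (gridPt T m (i - 1)),
          (k r + ν.real (D.cell l n)) ∂timeMeasure)
      ((hcm n).mono (𝓕.le _) le_rfl).aestronglyMeasurable ?_
    filter_upwards [hreg] with ω hω
    rw [norm_smul, mul_assoc]
    exact mul_le_mul_of_nonneg_left
      (hω.norm_integral_jump_le hsT hk (D.measure_cell_lt_top l n).ne _) (norm_nonneg _)
  obtain ⟨hW1, hW2⟩ := measurable_memLp_truncatedWiener (g := g) hW l hst htT hSm hS2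
  obtain ⟨hJ1, hJ2⟩ := measurable_memLp_jumps hN hst htT (D.cell_measurable l)
    (D.measure_cell_lt_top l) hcm hc2
  refine ⟨_, (hjw.add hW1).add hJ1, (hjw2.add hW2).add hJ2, ?_⟩
  filter_upwards [hN.ae_forall_lt_top (s := gridPt T m (i - 1)) htT (D.cell_measurable l)
    (D.measure_cell_lt_top l)] with ω hω
  have hjm : jumpMean D T m l F i ω (w ω)
      = fun ξ => ∑ n, (D.cell l n).indicator (fun _ => c n ω) ξ := by
    funext ξ
    rw [jumpMean, if_neg h2i]
  rw [explicitData, if_neg hi1, hjm, compensatedIntegral_sum_indicator (D.cell_measurable l)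
    (D.measure_cell_lt_top l) hω]
  rfl

/-- Solvability of the scheme on a grid that is so fine that the integrals of `K₁'` over its cells
are at most one. The embedding `j` need not have dense range, so that this applies to Galerkin
spaces as well. -/
theorem exists_unique_implicit_scheme [TopologicalSpace.SeparableSpace V]
    (hrefl : Function.Surjective (NormedSpace.inclusionInDoubleDual ℝ V))
    {j : V →L[ℝ] H} (hj : Function.Injective j) (h𝓕 : UsualConditions P 𝓕) (hT : 0 < T)
    {W : ℝ≥0 → U → Ω → ℝ} (hW : IsCylindricalWiener P 𝓕 T W)
    {N : Ω → Measure (ℝ≥0 × E)} (hN : IsPoissonRandomMeasure P 𝓕 T ν N)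
    (g : HilbertBasis {k : ℕ // (k : ℕ∞) < d} ℝ U) (D : JumpDiscretization ν)
    {A : ℝ≥0 → Ω → V → StrongDual ℝ V} (hA : ProgressivelyMeasurableCoeff 𝓕 T A)
    {B : ℝ≥0 → Ω → V → HilbertSchmidt g H} (hB : ProgressivelyMeasurableCoeff 𝓕 T B)
    {F : ℝ≥0 → Ω → V → E → H} (hF : PredictableCoeff 𝓕 T F)
    {p : ℝ} (hp : 2 ≤ p) {k lam K₁ K₁' : ℝ≥0 → ℝ}
    (hk : IntegrableOn k (Set.Iic T) timeMeasure) (hlam : PosIntegrable T lam)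
    (hK₁ : NonnegIntegrable T K₁) (hK₁' : NonnegIntegrable T K₁')
    (hreg : ∀ᵐ ω ∂P, IsRegularPath T ν j p k lam K₁ K₁' (fun t => A t ω) (fun t => B t ω)
        (fun t => F t ω))
    {ζ : Ω → H} (hζ : Measurable[𝓕 0] ζ) (hζ2 : MemLp ζ 2 P) (m l : ℕ)
    (hm : ∀ i, 1 ≤ i → i ≤ m →
      ∫ r in Set.Ioc (gridPt T m (i - 1)) (gridPt T m i), K₁' r ∂timeMeasure ≤ 1) :
    ∃ u : ℕ → Ω → V,
      SolvesImplicit P T j g D W N A B F ζ m l u ∧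
      (∀ i, 1 ≤ i → i ≤ m →
        Measurable[𝓕 (gridPt T m i)] (u i) ∧ ∫⁻ ω, ‖u i ω‖ₑ ^ p ∂P < ∞) ∧
      ∀ v : ℕ → Ω → V, SolvesImplicit P T j g D W N A B F ζ m l v →
        ∀ i, 1 ≤ i → i ≤ m → ∀ᵐ ω ∂P, v i ω = u i ω := by
  have hsep : TopologicalSpace.SeparableSpace (StrongDual ℝ V) :=
    separableSpace_strongDual_of_reflexive hrefl
  have hsec : SecondCountableTopology (StrongDual ℝ V) :=
    UniformSpace.secondCountable_of_separable _
  have hdis : ∀ i, 1 ≤ i → i ≤ m → ∀ᵐ ω ∂P, IsDissipativeFamily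
      (timeMeasure.restrict (Set.Ioc (gridPt T m (i - 1)) (gridPt T m i))) j p k lam K₁ K₁'
      (fun r => A r ω) := fun i hi him => by
    filter_upwards [hreg] with ω hω
    exact hω.isDissipativeFamily (gridPt_le him)
      (fun x => hA.aestronglyMeasurable (gridPt_le him) ω x) hk hlam.2 hK₁.2 hK₁'.2 (hm i hi him)
  have hex : ∀ n, n ≤ m → ∃ u : ℕ → Ω → V, ∀ i, 1 ≤ i → i ≤ n →
      (∀ᵐ ω ∂P, implicitOp (timeMeasure.restrict (Set.Ioc (gridPt T m (i - 1)) (gridPt T m i))) j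
        (fun r => A r ω) (u i ω)
          = pivot j (explicitData T j g D W N B F ζ m l i ω (u (i - 1) ω))) ∧
      Measurable[𝓕 (gridPt T m i)] (u i) ∧ ∫⁻ ω, ‖u i ω‖ₑ ^ p ∂P < ∞ := by
    intro n
    induction n with
    | zero => exact fun _ => ⟨fun _ _ => 0, fun i hi hi0 => by omega⟩
    | succ n ih =>
      intro hn
      obtain ⟨u, hu⟩ := ih (by omega)
      obtain ⟨h, hh1, hh2, hh3⟩ := exists_measurable_memLp_explicitData (l := l) (D := D) hW hN hB
        hF hp hk hreg hζ hζ2 (i := n + 1) (by omega) hn (w := u n)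
        (fun hn1 => (hu n (by omega) le_rfl).2)
      obtain ⟨x, hx1, hx2, hx3⟩ := exists_implicit_step hrefl hj h𝓕 hA (by linarith) (gridPt_le hn)
        (hdis (n + 1) (by omega) hn) (setIntegral_grid_pos hT hlam (by omega) hn) hh1 hh2
      refine ⟨Function.update u (n + 1) x, fun i hi hin => ?_⟩
      have hprev : Function.update u (n + 1) x (i - 1) = u (i - 1) :=
        Function.update_of_ne (by omega) _ _
      rw [hprev]
      rcases eq_or_ne i (n + 1) with rfl | hne
      · rw [Function.update_self]
        refine ⟨?_, hx1, hx2⟩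
        filter_upwards [hx3, hh3] with ω h1 h2
        rw [h1, Nat.add_sub_cancel, h2]
      · rw [Function.update_of_ne hne]
        exact hu i hi (by omega)
  obtain ⟨u, hu⟩ := hex m le_rfl
  refine ⟨u, fun i hi him => ?_, fun i hi him => (hu i hi him).2, fun v hv i hi him => ?_⟩
  · filter_upwards [(hu i hi him).1] with ω hω
    exact (implicit_equation_iff hT hi him).2 hω
  · induction i, hi using Nat.le_induction with
    | base =>
      filter_upwards [hv 1 le_rfl him, (hu 1 le_rfl him).1, hdis 1 le_rfl him] with ω h1 h2 h3
      refine h3.implicitOp_injective hj ?_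
      rw [h2, (implicit_equation_iff hT le_rfl him).1 h1, explicitData_one, explicitData_one]
    | succ n hn ih =>
      filter_upwards [hv (n + 1) (by omega) him, (hu (n + 1) (by omega) him).1,
        hdis (n + 1) (by omega) him, ih (by omega)] with ω h1 h2 h3 h4
      refine h3.implicitOp_injective hj ?_
      rw [h2, (implicit_equation_iff hT (by omega) him).1 h1, Nat.add_sub_cancel, h4]

end Core

/-! ### Galerkin projections -/

section Galerkin

variable {V H : Type*} [NormedAddCommGroup V] [NormedSpace ℝ V]
  [NormedAddCommGroup H] [InnerProductSpace ℝ H]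

theorem galerkinProj_add (b : Finset V) (f f' : StrongDual ℝ V) :
    galerkinProj b (f + f') = galerkinProj b f + galerkinProj b f' := by
  simp only [galerkinProj, add_apply, add_smul, Finset.sum_add_distrib]

theorem galerkinProj_smul (b : Finset V) (c : ℝ) (f : StrongDual ℝ V) :
    galerkinProj b (c • f) = c • galerkinProj b f := by
  simp only [galerkinProj, smul_apply, smul_eq_mul, Finset.smul_sum, mul_smul]

/-- The projection `Π_n` on `H`, as a bounded operator into `V`. -/
noncomputable def galerkinProjCLM (j : V →L[ℝ] H) (b : Finset V) : H →L[ℝ] V :=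
  ∑ e ∈ b, (innerSL ℝ (j e)).smulRight e

theorem galerkinProj_pivot (j : V →L[ℝ] H) (b : Finset V) (h : H) :
    galerkinProj b (pivot j h) = galerkinProjCLM j b h := by
  rw [galerkinProj, galerkinProjCLM, sum_apply]
  refine Finset.sum_congr rfl fun e _ => ?_
  rw [pivot_apply, ContinuousLinearMap.smulRight_apply, innerSL_apply_apply, real_inner_comm]

namespace SpaceDiscretization

variable {j : V →L[ℝ] H} (G : SpaceDiscretization j) (n : ℕ)

theorem basis_subset_space : (G.basis n : Set V) ⊆ G.space n := by
  rw [← G.span_basis n]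
  exact Submodule.subset_span

instance finiteDimensional_space : FiniteDimensional ℝ (G.space n) := by
  rw [← G.span_basis n]
  exact FiniteDimensional.span_finset ℝ _

theorem galerkinProj_mem (f : StrongDual ℝ V) : galerkinProj (G.basis n) f ∈ G.space n :=
  Submodule.sum_mem _ fun _ he => Submodule.smul_mem _ _ (G.basis_subset_space n he)

theorem inner_basis {e e' : V} (he : e ∈ G.basis n) (he' : e' ∈ G.basis n) [DecidableEq V] :
    inner ℝ (j e) (j e') = if e = e' then (1 : ℝ) else 0 := by
  have h := orthonormal_iff_ite.1 (G.orthonormal n) ⟨e, he⟩ ⟨e', he'⟩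
  simpa only [Subtype.mk.injEq] using h

theorem inner_galerkinProj (f : StrongDual ℝ V) {e : V} (he : e ∈ G.basis n) :
    inner ℝ (j (galerkinProj (G.basis n) f)) (j e) = f e := by
  classical
  rw [galerkinProj, map_sum, sum_inner, Finset.sum_eq_single e]
  · rw [map_smul, real_inner_smul_left, G.inner_basis n he he, if_pos rfl, mul_one]
  · intro e' he' hne
    rw [map_smul, real_inner_smul_left, G.inner_basis n he' he, if_neg hne, mul_zero]
  · exact fun h => absurd he h

theorem comp_subtypeL_eq_iff {f f' : StrongDual ℝ V} :
    f.comp (G.space n).subtypeL = f'.comp (G.space n).subtypeL ↔ ∀ e ∈ G.basis n, f e = f' e := by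
  constructor
  · intro h e he
    exact DFunLike.congr_fun h (⟨e, G.basis_subset_space n he⟩ : G.space n)
  · intro h
    have h1 : Set.EqOn f.toLinearMap f'.toLinearMap (Submodule.span ℝ (G.basis n : Set V)) :=
      LinearMap.eqOn_span' fun e he => h e he
    rw [G.span_basis n] at h1
    exact ContinuousLinearMap.ext fun x => h1 x.2

/-- Two functionals have the same projection iff they agree on the Galerkin space. -/
theorem galerkinProj_eq_iff {f f' : StrongDual ℝ V} :
    galerkinProj (G.basis n) f = galerkinProj (G.basis n) f' ↔
      f.comp (G.space n).subtypeL = f'.comp (G.space n).subtypeL := by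
  rw [G.comp_subtypeL_eq_iff n]
  constructor
  · intro h e he
    rw [← G.inner_galerkinProj n f he, h, G.inner_galerkinProj n f' he]
  · intro h
    exact Finset.sum_congr rfl fun e he => by rw [h e he]

theorem galerkinProj_pivot_of_mem {x : V} (hx : x ∈ G.space n) :
    galerkinProj (G.basis n) (pivot j (j x)) = x := by
  classical
  rw [galerkinProj_pivot]
  have h1 : Set.EqOn ((galerkinProjCLM j (G.basis n)).comp j).toLinearMap
      (LinearMap.id (R := ℝ) (M := V)) (Submodule.span ℝ (G.basis n : Set V)) := by
    refine LinearMap.eqOn_span' fun e he => ?_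
    change galerkinProjCLM j (G.basis n) (j e) = e
    rw [← galerkinProj_pivot, galerkinProj, Finset.sum_eq_single e]
    · rw [pivot_apply, G.inner_basis n he he, if_pos rfl, one_smul]
    · intro e' he' hne
      rw [pivot_apply, G.inner_basis n he he', if_neg hne.symm, zero_smul]
    · exact fun h => absurd he h
  rw [G.span_basis n] at h1
  exact h1 hx

end SpaceDiscretization

end Galerkin

/-! ### Restriction of the coefficients to a Galerkin space -/

section Restriction

variable {V H U E Ω : Type*} [NormedAddCommGroup V] [NormedSpace ℝ V]
  [NormedAddCommGroup H] [InnerProductSpace ℝ H]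

/-- The restriction of functionals to a subspace. -/
noncomputable def restrictDual (S : Submodule ℝ V) : StrongDual ℝ V →L[ℝ] StrongDual ℝ S :=
  (ContinuousLinearMap.compL ℝ S V ℝ).flip S.subtypeL

theorem restrictDual_apply (S : Submodule ℝ V) (f : StrongDual ℝ V) :
    restrictDual S f = f.comp S.subtypeL := rfl

theorem norm_restrictDual_le (S : Submodule ℝ V) (f : StrongDual ℝ V) : ‖restrictDual S f‖ ≤ ‖f‖ :=
  ContinuousLinearMap.opNorm_le_bound _ (norm_nonneg _) fun x => f.le_opNorm x

/-- The restriction of a `V*`-valued coefficient to a subspace and its dual. -/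
noncomputable def restrictCoeff (S : Submodule ℝ V) (A : ℝ≥0 → Ω → V → StrongDual ℝ V) :
    ℝ≥0 → Ω → S → StrongDual ℝ S :=
  fun t ω x => restrictDual S (A t ω x)

theorem IsRegularPath.restrict {Y : Type*} [NormedAddCommGroup Y] [MeasurableSpace E] {T : ℝ≥0}
    {ν : Measure E} {j : V →L[ℝ] H} {p : ℝ}
    {k lam K₁ K₁' : ℝ≥0 → ℝ} {a : ℝ≥0 → V → StrongDual ℝ V} {b : ℝ≥0 → V → Y}
    {f : ℝ≥0 → V → E → H} (h : IsRegularPath T ν j p k lam K₁ K₁' a b f) (S : Submodule ℝ V) :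
    IsRegularPath T ν (j.comp S.subtypeL) p k lam K₁ K₁' (fun t (x : S) => restrictDual S (a t x))
      (fun t (x : S) => b t x) (fun t (x : S) => f t x) where
  mono t ht x y := h.mono t ht x y
  hemi t ht x w := h.hemi t ht x w
  growth t ht x := (norm_restrictDual_le S _).trans (h.growth t ht x)
  coer t ht x := h.coer t ht x
  diffusion t ht x := h.diffusion t ht x
  integrable_jump t ht x := h.integrable_jump t ht x
  jump t ht x := h.jump t ht x

variable {mΩ : MeasurableSpace Ω} {𝓕 : Filtration ℝ≥0 mΩ} {T : ℝ≥0} [MeasurableSpace V]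

theorem ProgressivelyMeasurableCoeff.restrict {Y : Type*} [MeasurableSpace Y] {G : ℝ≥0 → Ω → V → Y}
    (hG : ProgressivelyMeasurableCoeff 𝓕 T G) (S : Submodule ℝ V) :
    ProgressivelyMeasurableCoeff 𝓕 T (fun t ω (x : S) => G t ω x) := by
  let : MeasurableSpace (Set.Iic T × Ω) := progressiveSigma 𝓕 T
  have hm : Measurable fun z : (Set.Iic T × Ω) × S => ((z.1, (z.2 : V)) : (Set.Iic T × Ω) × V) :=
    measurable_fst.prodMk (measurable_subtype_coe.comp measurable_snd)
  exact Measurable.comp hG hm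

theorem ProgressivelyMeasurableCoeff.restrictCoeff {A : ℝ≥0 → Ω → V → StrongDual ℝ V}
    (hA : ProgressivelyMeasurableCoeff 𝓕 T A) (S : Submodule ℝ V) :
    ProgressivelyMeasurableCoeff 𝓕 T (restrictCoeff S A) :=
  (restrictDual S).continuous.measurable.comp (hA.restrict S)

theorem PredictableCoeff.restrict {Y : Type*} [MeasurableSpace Y] [MeasurableSpace E]
    {G : ℝ≥0 → Ω → V → E → Y} (hG : PredictableCoeff 𝓕 T G) (S : Submodule ℝ V) :
    PredictableCoeff 𝓕 T (fun t ω (x : S) => G t ω x) := by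
  let : MeasurableSpace (Set.Iic T × Ω) := predictableSigma 𝓕 T
  have hm : Measurable fun z : ((Set.Iic T × Ω) × S) × E =>
      (((z.1.1, (z.1.2 : V)), z.2) : ((Set.Iic T × Ω) × V) × E) :=
    ((measurable_fst.comp measurable_fst).prodMk
      (measurable_subtype_coe.comp (measurable_snd.comp measurable_fst))).prodMk measurable_snd
  exact Measurable.comp hG hm

end Restriction

/-! ### The projected scheme -/

section ProjectedScheme

theorem compensatedIntegral_comp {X X' E : Type*} [NormedAddCommGroup X] [NormedSpace ℝ X]
    [CompleteSpace X] [NormedAddCommGroup X'] [NormedSpace ℝ X'] [CompleteSpace X']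
    [MeasurableSpace E] {ν : Measure E} [SFinite ν] {M : Measure (ℝ≥0 × E)} {s t : ℝ≥0} {r : ℕ}
    {cell : Fin r → Set E} (hc : ∀ i, MeasurableSet (cell i)) (hν : ∀ i, ν (cell i) < ∞)
    (hM : ∀ i, M (Set.Ioc s t ×ˢ cell i) < ∞) (c : Fin r → X) (L : X →L[ℝ] X') :
    compensatedIntegral ν M s t (fun ξ => L (∑ i, (cell i).indicator (fun _ => c i) ξ))
      = L (compensatedIntegral ν M s t (fun ξ => ∑ i, (cell i).indicator (fun _ => c i) ξ)) := by
  simp only [compensatedIntegral]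
  rw [map_sub, L.integral_comp_comm (integrableOn_sum_indicator hc hM c),
    L.integral_comp_comm (integrableOn_sum_indicator hc
      (fun i => timeMeasure_prod_Ioc_lt_top (hν i)) c)]

variable {V H U E Ω : Type*} [NormedAddCommGroup V] [NormedSpace ℝ V] [CompleteSpace V]
  [NormedAddCommGroup H] [InnerProductSpace ℝ H] [CompleteSpace H]
  [NormedAddCommGroup U] [InnerProductSpace ℝ U]
  [MetricSpace E] [MeasurableSpace E] {ν : Measure E} [SFinite ν] {d : ℕ∞}

theorem compensatedIntegral_jumpMean_comp {T : ℝ≥0} {D : JumpDiscretization ν} {m l i : ℕ}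
    {F : ℝ≥0 → Ω → V → E → H} {ω : Ω} {x : V} {M : Measure (ℝ≥0 × E)} {s t : ℝ≥0}
    (hM : ∀ i, M (Set.Ioc s t ×ˢ D.cell l i) < ∞) (L : H →L[ℝ] V) :
    compensatedIntegral ν M s t (fun ξ => L (jumpMean D T m l F i ω x ξ))
      = L (compensatedIntegral ν M s t (jumpMean D T m l F i ω x)) := by
  obtain ⟨c, hc⟩ : ∃ c : Fin (D.r l) → H, jumpMean D T m l F i ω x
      = fun ξ => ∑ n, (D.cell l n).indicator (fun _ => c n) ξ := by
    by_cases hi : i ≤ 1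
    · exact ⟨0, funext fun ξ => by simp [jumpMean, hi]⟩
    · exact ⟨_, funext fun ξ => by rw [jumpMean, if_neg hi]⟩
  rw [hc]
  exact compensatedIntegral_comp (D.cell_measurable l) (D.measure_cell_lt_top l) hM c L

/-- The equation projected to `V_n` is the unprojected equation for the coefficients restricted to
`V_n`: both say that the same functionals agree on `V_n`. -/
theorem projected_equation_iff {T : ℝ≥0} {j : V →L[ℝ] H} (G : SpaceDiscretization j) (n : ℕ)
    {g : HilbertBasis {k : ℕ // (k : ℕ∞) < d} ℝ U} {D : JumpDiscretization ν}
    {W : ℝ≥0 → U → Ω → ℝ} {N : Ω → Measure (ℝ≥0 × E)}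
    {A : ℝ≥0 → Ω → V → StrongDual ℝ V} {B : ℝ≥0 → Ω → V → HilbertSchmidt g H}
    {F : ℝ≥0 → Ω → V → E → H} {ζ : Ω → H} {m l i : ℕ} (hi : 1 ≤ i) {ω : Ω} {x w : G.space n}
    (hw : i = 1 → (w : V) = galerkinProj (G.basis n) (pivot j (ζ ω)))
    (hint : IntegrableOn (fun r => A r ω x) (Set.Ioc (gridPt T m (i - 1)) (gridPt T m i))
      timeMeasure)
    (hM : ∀ c, N ω (Set.Ioc (gridPt T m (i - 1)) (gridPt T m i) ×ˢ D.cell l c) < ∞) :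
    (x : V) = w + stepSize T m • galerkinProj (G.basis n) (currentMean T m A i ω x)
      + galerkinProj (G.basis n) (pivot j ((precedingMean T m B i ω (w : V)).toCLM
          (truncatedWiener g W l (gridPt T m i) ω - truncatedWiener g W l (gridPt T m (i - 1)) ω)))
      + compensatedIntegral ν (N ω) (gridPt T m (i - 1)) (gridPt T m i) (fun ξ =>
          galerkinProj (G.basis n) (pivot j (jumpMean D T m l F i ω (w : V) ξ))) ↔
    pivot (j.comp (G.space n).subtypeL) ((j.comp (G.space n).subtypeL) x)
      = pivot (j.comp (G.space n).subtypeL)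
          (if i = 1 then ζ ω else (j.comp (G.space n).subtypeL) w)
      + stepSize T m • currentMean T m (restrictCoeff (G.space n) A) i ω x
      + pivot (j.comp (G.space n).subtypeL)
          ((precedingMean T m (fun t ω (x : G.space n) => B t ω x) i ω w).toCLM
          (truncatedWiener g W l (gridPt T m i) ω - truncatedWiener g W l (gridPt T m (i - 1)) ω))
      + pivot (j.comp (G.space n).subtypeL)
          (compensatedIntegral ν (N ω) (gridPt T m (i - 1)) (gridPt T m i)
          (jumpMean D T m l (fun t ω (x : G.space n) => F t ω x) i ω w)) := by
  have h1 : (w : V) = galerkinProj (G.basis n) (pivot j (if i = 1 then ζ ω else j w)) := by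
    split_ifs with h
    · exact hw h
    · exact (G.galerkinProj_pivot_of_mem n w.2).symm
  have h2 : currentMean T m (restrictCoeff (G.space n) A) i ω x
      = restrictDual (G.space n) (currentMean T m A i ω x) := by
    have h := ContinuousLinearMap.integral_comp_comm (𝕜 := ℝ)
      (Fₗ := StrongDual ℝ (G.space n)) (restrictDual (G.space n)) hint
    rw [currentMean, currentMean, if_neg (by omega), if_neg (by omega), map_smul, ← h]
    rfl
  have h3 : compensatedIntegral ν (N ω) (gridPt T m (i - 1)) (gridPt T m i) (fun ξ =>
          galerkinProj (G.basis n) (pivot j (jumpMean D T m l F i ω (w : V) ξ)))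
      = galerkinProj (G.basis n) (pivot j
          (compensatedIntegral ν (N ω) (gridPt T m (i - 1)) (gridPt T m i)
            (jumpMean D T m l F i ω (w : V)))) := by
    simp_rw [galerkinProj_pivot]
    exact compensatedIntegral_jumpMean_comp hM _
  have h4 : ∀ h : H, pivot (j.comp (G.space n).subtypeL) h = restrictDual (G.space n) (pivot j h) :=
    fun h => rfl
  have h5 : (j.comp (G.space n).subtypeL) w = j w := rfl
  have h6 : (j.comp (G.space n).subtypeL) x = j x := rfl
  have h7 : precedingMean T m (fun t ω (x : G.space n) => B t ω x) i ω w
      = precedingMean T m B i ω (w : V) := rfl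
  have h8 : jumpMean D T m l (fun t ω (x : G.space n) => F t ω x) i ω w
      = jumpMean D T m l F i ω (w : V) := rfl
  rw [h3, h2, h5, h6, h7, h8, h4, h4, h4, h4, ← map_smul, ← map_add, ← map_add, ← map_add,
    restrictDual_apply, restrictDual_apply, ← G.galerkinProj_eq_iff n,
    G.galerkinProj_pivot_of_mem n x.2, galerkinProj_add, galerkinProj_add, galerkinProj_add,
    galerkinProj_smul, ← h1]

/-- The value `u 0` does not enter the scheme without projection. -/
theorem SolvesImplicit.congr_of_one_le {V H U E Ω : Type*} [NormedAddCommGroup V] [NormedSpace ℝ V]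
    [NormedAddCommGroup H] [InnerProductSpace ℝ H] [NormedAddCommGroup U] [InnerProductSpace ℝ U]
    [MetricSpace E] [MeasurableSpace E] {mΩ : MeasurableSpace Ω} {P : Measure Ω} {d : ℕ∞}
    {T : ℝ≥0} (hT : 0 < T) {j : V →L[ℝ] H}
    {g : HilbertBasis {k : ℕ // (k : ℕ∞) < d} ℝ U} {ν : Measure E} {D : JumpDiscretization ν}
    {W : ℝ≥0 → U → Ω → ℝ} {N : Ω → Measure (ℝ≥0 × E)}
    {A : ℝ≥0 → Ω → V → StrongDual ℝ V} {B : ℝ≥0 → Ω → V → HilbertSchmidt g H}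
    {F : ℝ≥0 → Ω → V → E → H} {ζ : Ω → H} {m l : ℕ} {u u' : ℕ → Ω → V}
    (h : SolvesImplicit P T j g D W N A B F ζ m l u) (hu : ∀ i, 1 ≤ i → u' i = u i) :
    SolvesImplicit P T j g D W N A B F ζ m l u' := by
  intro i hi him
  filter_upwards [h i hi him] with ω hω
  rw [implicit_equation_iff hT hi him] at hω ⊢
  rw [hu i hi, hω]
  rcases eq_or_ne i 1 with rfl | hne
  · rw [explicitData_one, explicitData_one]
  · rw [hu (i - 1) (by omega)]

variable {V H U E Ω : Type*} [NormedAddCommGroup V] [NormedSpace ℝ V] [CompleteSpace V]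
  [TopologicalSpace.SeparableSpace V] [MeasurableSpace V] [BorelSpace V]
  [NormedAddCommGroup H] [InnerProductSpace ℝ H] [CompleteSpace H]
  [TopologicalSpace.SeparableSpace H] [MeasurableSpace H] [BorelSpace H]
  [NormedAddCommGroup U] [InnerProductSpace ℝ U]
  [MetricSpace E] [MeasurableSpace E] {ν : Measure E} [SFinite ν]
  {mΩ : MeasurableSpace Ω} {P : Measure Ω} [IsProbabilityMeasure P] {𝓕 : Filtration ℝ≥0 mΩ}
  {T : ℝ≥0} {d : ℕ∞}

/-- Solvability of the projected scheme, obtained from the scheme without projection on the finite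
dimensional space `V_n`. -/
theorem exists_unique_projected_scheme
    (hrefl : Function.Surjective (NormedSpace.inclusionInDoubleDual ℝ V))
    {j : V →L[ℝ] H} (hj : Function.Injective j) (h𝓕 : UsualConditions P 𝓕) (hT : 0 < T)
    {W : ℝ≥0 → U → Ω → ℝ} (hW : IsCylindricalWiener P 𝓕 T W)
    {N : Ω → Measure (ℝ≥0 × E)} (hN : IsPoissonRandomMeasure P 𝓕 T ν N)
    (G : SpaceDiscretization j)
    (g : HilbertBasis {k : ℕ // (k : ℕ∞) < d} ℝ U) (D : JumpDiscretization ν)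
    {A : ℝ≥0 → Ω → V → StrongDual ℝ V} (hA : ProgressivelyMeasurableCoeff 𝓕 T A)
    {B : ℝ≥0 → Ω → V → HilbertSchmidt g H} (hB : ProgressivelyMeasurableCoeff 𝓕 T B)
    {F : ℝ≥0 → Ω → V → E → H} (hF : PredictableCoeff 𝓕 T F)
    {p : ℝ} (hp : 2 ≤ p) {k lam K₁ K₁' : ℝ≥0 → ℝ}
    (hk : IntegrableOn k (Set.Iic T) timeMeasure) (hlam : PosIntegrable T lam)
    (hK₁ : NonnegIntegrable T K₁) (hK₁' : NonnegIntegrable T K₁')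
    (hreg : ∀ᵐ ω ∂P, IsRegularPath T ν j p k lam K₁ K₁' (fun t => A t ω) (fun t => B t ω)
        (fun t => F t ω))
    {ζ : Ω → H} (hζ : Measurable[𝓕 0] ζ) (hζ2 : MemLp ζ 2 P) (n m l : ℕ)
    (hm : ∀ i, 1 ≤ i → i ≤ m →
      ∫ r in Set.Ioc (gridPt T m (i - 1)) (gridPt T m i), K₁' r ∂timeMeasure ≤ 1) :
    ∃ u : ℕ → Ω → V,
      SolvesProjectedImplicit P T j G g D W N A B F ζ n m l u ∧
      (∀ i, i ≤ m → Measurable[𝓕 (gridPt T m i)] (u i)) ∧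
      (∀ i, 1 ≤ i → i ≤ m → ∫⁻ ω, ‖u i ω‖ₑ ^ p ∂P < ∞) ∧
      (∫⁻ ω, ‖ζ ω‖ₑ ^ p ∂P < ∞ → ∫⁻ ω, ‖u 0 ω‖ₑ ^ p ∂P < ∞) ∧
      ∀ v : ℕ → Ω → V, SolvesProjectedImplicit P T j G g D W N A B F ζ n m l v →
        ∀ i, i ≤ m → ∀ᵐ ω ∂P, v i ω = u i ω := by
  classical
  have hsep : TopologicalSpace.SeparableSpace (StrongDual ℝ V) :=
    separableSpace_strongDual_of_reflexive hrefl
  have hsec : SecondCountableTopology (StrongDual ℝ V) :=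
    UniformSpace.secondCountable_of_separable _
  obtain ⟨u, hu1, hu2, hu3⟩ := exists_unique_implicit_scheme
    (V := G.space n) surjective_inclusionInDoubleDual_of_finiteDimensional
    (j := j.comp (G.space n).subtypeL) (fun x y h => Subtype.ext (hj h)) h𝓕 hT hW hN g D
    (hA.restrictCoeff (G.space n)) (hB.restrict (G.space n)) (hF.restrict (G.space n)) hp hk hlam
    hK₁ hK₁' (hreg.mono fun ω hω => hω.restrict (G.space n)) hζ hζ2 m l hm
  -- almost surely, the projected and the restricted equation are equivalent
  have hequiv : ∀ i, 1 ≤ i → i ≤ m → ∀ᵐ ω ∂P, ∀ x w : G.space n,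
      (i = 1 → (w : V) = galerkinProj (G.basis n) (pivot j (ζ ω))) → (_ ↔ _) := fun i hi him => by
    filter_upwards [hreg, hN.ae_forall_lt_top (s := gridPt T m (i - 1)) (gridPt_le him)
      (D.cell_measurable l) (D.measure_cell_lt_top l)] with ω h1 h2 x w hw
    have hint := (h1.isDissipativeFamily (gridPt_le him)
      (fun x => hA.aestronglyMeasurable (gridPt_le him) ω x) hk hlam.2 hK₁.2 hK₁'.2
      (hm i hi him)).integrable x
    exact projected_equation_iff (g := g) (W := W) (B := B) (F := F) G n hi hw hint h2
  let z : Ω → G.space n := fun ω =>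
    ⟨galerkinProj (G.basis n) (pivot j (ζ ω)), G.galerkinProj_mem n _⟩
  -- the solution on `V_n`, with the value at time `0` that the projected scheme prescribes
  let u' : ℕ → Ω → G.space n := Function.update u 0 z
  have hu'0 : u' 0 = z := Function.update_self ..
  have hu' : ∀ i, 1 ≤ i → u' i = u i := fun i hi => Function.update_of_ne (by omega) _ _
  have hsol := hu1.congr_of_one_le hT hu'
  refine ⟨fun i ω => u' i ω, ⟨?_, fun i hi him => ?_⟩, fun i him => ?_, fun i hi him => ?_, ?_, ?_⟩
  · exact Eventually.of_forall fun ω => by simp only [hu'0, z]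
  · filter_upwards [hequiv i hi him, hsol i hi him] with ω h1 h2
    refine (h1 (u' i ω) (u' (i - 1) ω) ?_).2 h2
    rintro rfl
    rw [Nat.sub_self, hu'0]
  · rcases Nat.eq_zero_or_pos i with rfl | hi
    · rw [gridPt_zero]
      simp only [hu'0, z, galerkinProj_pivot]
      exact (galerkinProjCLM j (G.basis n)).continuous.measurable.comp hζ
    · simp only [hu' i hi]
      exact measurable_subtype_coe.comp (hu2 i hi him).1
  · simp only [hu' i hi]
    exact (hu2 i hi him).2
  · intro hζp
    simp only [hu'0, z, galerkinProj_pivot]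
    set L := galerkinProjCLM j (G.basis n)
    have hle : ∀ ω, ‖L (ζ ω)‖ₑ ^ p ≤ ‖L‖ₑ ^ p * ‖ζ ω‖ₑ ^ p := fun ω => by
      rw [← ENNReal.mul_rpow_of_nonneg _ _ (by linarith)]
      exact ENNReal.rpow_le_rpow (L.le_opENorm _) (by linarith)
    refine lt_of_le_of_lt (lintegral_mono hle) ?_
    have hc : ‖L‖ₑ ^ p ≠ ∞ := ENNReal.rpow_ne_top_of_nonneg (by linarith) enorm_ne_top
    rw [lintegral_const_mul' _ _ hc]
    exact ENNReal.mul_lt_top hc.lt_top hζp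
  · rintro v ⟨hv0, hv⟩
    -- a solution takes its values in `V_n`
    have hmem : ∀ i, i ≤ m → ∀ᵐ ω ∂P, v i ω ∈ G.space n := by
      intro i
      induction i with
      | zero =>
        intro _
        filter_upwards [hv0] with ω h
        rw [h]
        exact G.galerkinProj_mem n _
      | succ i ih =>
        intro him
        filter_upwards [ih (by omega), hv (i + 1) (by omega) him,
          hN.ae_forall_lt_top (s := gridPt T m i) (gridPt_le him)
          (D.cell_measurable l) (D.measure_cell_lt_top l)] with ω h1 h2 h3
        simp_rw [galerkinProj_pivot, Nat.add_sub_cancel] at h2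
        rw [compensatedIntegral_jumpMean_comp h3] at h2
        simp_rw [← galerkinProj_pivot] at h2
        rw [h2]
        exact add_mem (add_mem (add_mem h1 (Submodule.smul_mem _ _ (G.galerkinProj_mem n _)))
          (G.galerkinProj_mem n _)) (G.galerkinProj_mem n _)
    let v' : ℕ → Ω → G.space n := fun i ω => if h : v i ω ∈ G.space n then ⟨v i ω, h⟩ else 0
    have hv' : ∀ i ω, v i ω ∈ G.space n → (v' i ω : V) = v i ω := fun i ω h => by
      simp only [v', dif_pos h]
    have hsol' : SolvesImplicit P T (j.comp (G.space n).subtypeL) g D W N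
        (restrictCoeff (G.space n) A) (fun t ω (x : G.space n) => B t ω x)
        (fun t ω (x : G.space n) => F t ω x) ζ m l v' := by
      intro i hi him
      filter_upwards [hequiv i hi him, hmem i him, hmem (i - 1) (by omega), hv i hi him, hv0]
        with ω h1 h2 h3 h4 h5
      refine (h1 (v' i ω) (v' (i - 1) ω) ?_).1 ?_
      · rintro rfl
        rw [hv' _ ω h3]
        exact h5
      · rw [hv' _ ω h2, hv' _ ω h3]
        exact h4
    intro i him
    rcases Nat.eq_zero_or_pos i with rfl | hi
    · filter_upwards [hv0] with ω h
      simp only [h, hu'0, z]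
    · filter_upwards [hu3 v' hsol' i hi him, hmem i him] with ω h1 h2
      rw [hu' i hi, ← h1, hv' _ ω h2]

end ProjectedScheme

theorem mainTheorem6
    {V H U E Ω : Type*}
    -- the Gelfand triple `V → H → V*`
    [NormedAddCommGroup V] [NormedSpace ℝ V] [CompleteSpace V]
    [TopologicalSpace.SeparableSpace V] [MeasurableSpace V] [BorelSpace V]
    (hrefl : Function.Surjective (NormedSpace.inclusionInDoubleDual ℝ V))
    [NormedAddCommGroup H] [InnerProductSpace ℝ H] [CompleteSpace H]
    [MeasurableSpace H] [BorelSpace H]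
    (j : V →L[ℝ] H) (hj : Function.Injective j) (hjd : DenseRange j)
    -- the noise
    [NormedAddCommGroup U] [InnerProductSpace ℝ U] [CompleteSpace U]
    [MetricSpace E] [MeasurableSpace E] [BorelSpace E] (ν : Measure E) [SigmaFinite ν]
    {mΩ : MeasurableSpace Ω} (P : Measure Ω) [IsProbabilityMeasure P]
    (𝓕 : Filtration ℝ≥0 mΩ) (h𝓕 : UsualConditions P 𝓕)
    (T : ℝ≥0) (hT : 0 < T)
    (W : ℝ≥0 → U → Ω → ℝ) (hW : IsCylindricalWiener P 𝓕 T W)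
    (N : Ω → Measure (ℝ≥0 × E)) (hN : IsPoissonRandomMeasure P 𝓕 T ν N)
    (hWN : NoisesIndependent P T W N)
    -- the discretizations of `V`, `U` and `E`
    (G : SpaceDiscretization j)
    {d : ℕ∞} (g : HilbertBasis {k : ℕ // (k : ℕ∞) < d} ℝ U)
    (D : JumpDiscretization ν)
    -- the coefficients and the initial value
    (A : ℝ≥0 → Ω → V → StrongDual ℝ V) (hA : ProgressivelyMeasurableCoeff 𝓕 T A)
    (B : ℝ≥0 → Ω → V → HilbertSchmidt g H) (hB : ProgressivelyMeasurableCoeff 𝓕 T B)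
    (F : ℝ≥0 → Ω → V → E → H) (hF : PredictableCoeff 𝓕 T F)
    (p q : ℝ) (hp : 2 ≤ p) (hpq : 1 / p + 1 / q = 1)
    (lam K₁ K₁' K₂ : ℝ≥0 → ℝ) (hlam : PosIntegrable T lam) (hK₁ : NonnegIntegrable T K₁)
    (hK₁' : NonnegIntegrable T K₁') (hK₂ : NonnegIntegrable T K₂)
    (hmono : MonotonicityCondition P T ν A B F)
    (hcoer : CoercivityCondition j P T ν p lam K₁ K₁' A B F)
    (hgrowth : GrowthCondition P T p q lam K₂ A)
    (hhemi : HemicontinuityCondition P T A)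
    (ζ : Ω → H) (hζ : Measurable[𝓕 0] ζ) (hζ2 : MemLp ζ 2 P) :
    (∃ m₀ : ℕ, 1 ≤ m₀ ∧ ∀ m l : ℕ, m₀ ≤ m → 1 ≤ l →
      ∃ u : ℕ → Ω → V,
        SolvesImplicit P T j g D W N A B F ζ m l u ∧
        (∀ i, 1 ≤ i → i ≤ m →
          Measurable[𝓕 (gridPt T m i)] (u i) ∧ ∫⁻ ω, ‖u i ω‖ₑ ^ p ∂P < ∞) ∧
        ∀ v : ℕ → Ω → V, SolvesImplicit P T j g D W N A B F ζ m l v →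
          ∀ i, 1 ≤ i → i ≤ m → ∀ᵐ ω ∂P, v i ω = u i ω) ∧
    (∃ m₀ : ℕ, 1 ≤ m₀ ∧ ∀ n m l : ℕ, 1 ≤ n → m₀ ≤ m → 1 ≤ l →
      ∃ u : ℕ → Ω → V,
        SolvesProjectedImplicit P T j G g D W N A B F ζ n m l u ∧
        (∀ i, i ≤ m → Measurable[𝓕 (gridPt T m i)] (u i)) ∧
        (∀ i, 1 ≤ i → i ≤ m → ∫⁻ ω, ‖u i ω‖ₑ ^ p ∂P < ∞) ∧
        (∫⁻ ω, ‖ζ ω‖ₑ ^ p ∂P < ∞ → ∫⁻ ω, ‖u 0 ω‖ₑ ^ p ∂P < ∞) ∧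
        ∀ v : ℕ → Ω → V, SolvesProjectedImplicit P T j G g D W N A B F ζ n m l v →
          ∀ i, i ≤ m → ∀ᵐ ω ∂P, v i ω = u i ω) := by 
  obtain ⟨k, hk, hreg⟩ :=
    exists_forall_isRegularPath hp hpq hlam hK₁ hK₁' hK₂ hmono hcoer hgrowth hhemi
  obtain ⟨m₀, hm₀, hm⟩ := exists_forall_setIntegral_grid_le hK₁'.2
  have hsepH : TopologicalSpace.SeparableSpace H := hjd.separableSpace j.continuous
  exact ⟨⟨m₀, hm₀, fun m l hmm _ => exists_unique_implicit_scheme hrefl hj h𝓕 hT hW hN g D hA hB hF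
      hp hk hlam hK₁ hK₁' hreg hζ hζ2 m l (hm m hmm)⟩,
    ⟨m₀, hm₀, fun n m l _ hmm _ => exists_unique_projected_scheme hrefl hj h𝓕 hT hW hN G g D hA hB
      hF hp hk hlam hK₁ hK₁' hreg hζ hζ2 n m l (hm m hmm)⟩⟩
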